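/- Let $N,K\ge 1$ be integers, $1<p<\frac53$, $\alpha>0$, let $y_1,\dots,y_K\in\mathbb R^3$ be pairwise distinct and $V(x)=-\sum_{k=1}^K|x-y_k|^{-1}$ on $\mathbb R^3$. For $\Psi\in H^1(\mathbb R^{3N},\mathbb C)$ put $$\mathcal E_\alpha(\Psi)=\sum_{i=1}^N\int_{\mathbb R^{3N}}\big(|\nabla_{x_i}\Psi|^2+V(x_i)|\Psi|^2\big)\,dx_1\cdots dx_N-\frac{\alpha^{2p-2}}{p}\int_{\mathbb R^3}\rho_\Psi^{\,p}\,dx ,$$ where $\rho_\Psi(x)=\sum_{i=1}^N\int_{\mathbb R^{3(N-1)}}|\Psi(x_1,\dots,x_{i-1},x,x_{i+1},\dots,x_N)|^2\prod_{j\ne i}dx_j$, and for $u_1,\dots,u_N\in H^1(\mathbb R^3,\mathbb R)$ put $$\mathcal E_\alpha(u_1,\dots,u_N)=\sum_{i=1}^N\int_{\mathbb R^3}\big(|\nabla u_i|^2+V|u_i|^2\big)\,dx-\frac{\alpha^{2p-2}}{p}\int_{\mathbb R^3}\Big(\sum_{i=1}^N|u_i|^2\Big)^p dx .$$ Define $$E_f(N)=\inf\{\mathcal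 E_\alpha(\Psi):\Psi\in H^1(\mathbb R^{3N},\mathbb C)\text{ antisymmetric},\ \|\Psi\|_{L^2}=1\},$$ $$J_\alpha(N)=\inf\{\mathcal E_\alpha(u_1,\dots,u_N):u_i\in H^1(\mathbb R^3,\mathbb R),\ (u_i,u_j)_{L^2}=\delta_{ij}\text{ for } i,j=1,\dots,N\}.$$ Then $$E_f(N)=J_\alpha(N).$$ Moreover, $J_\alpha(N)$ is the infimum of $\mathcal E_\alpha$ over Slater determinants: $$J_\alpha(N)=\inf\{\mathcal E_\alpha(\Psi):\Psi\in H^1(\mathbb R^{3N},\mathbb R),\ \|\Psi\|_{L^2}=1,\ \Psi\text{ is a Slater determinant}\},$$ where a Slater determinant is a function $\Psi=(N!)^{-1/2}\det\big(u_i(x_j)\big)_{i,j=1}^N$ with $u_1,\dots,u_N\in L^2(\mathbb R^3,\mathbb C)$ orthonormal in $L^2(\mathbb R^3,\mathbb C)$. -/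

import Mathlib

open MeasureTheory
open scoped ContDiff

noncomputable section

namespace FermionicNLS

/-! ### Weak derivatives and the Sobolev space `H¹` -/

section Sobolev

variable {X F : Type*} [NormedAddCommGroup X] [NormedSpace ℝ X] [MeasureSpace X]
  [NormedAddCommGroup F] [NormedSpace ℝ F]

/-- `g` is the weak derivative of `f` in the direction `v`, tested against real `C_c^∞`
functions (`f` and `g` will always be square integrable). -/
def HasWeakDeriv (f g : X → F) (v : X) : Prop :=
  ∀ φ : X → ℝ, ContDiff ℝ ∞ φ → HasCompactSupport φ →
    ∫ x, (fderiv ℝ φ x v) • f x = - ∫ x, φ x • g x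

/-- `f ∈ H¹(X, F)`: `f` and all its first order weak derivatives are in `L²`. -/
def MemH1 (f : X → F) : Prop :=
  MemLp f 2 volume ∧ ∀ v : X, ∃ g : X → F, MemLp g 2 volume ∧ HasWeakDeriv f g v

open Classical in
/-- The square integrable weak derivative of `f` in the direction `v` (a representative, unique
almost everywhere by `HasWeakDeriv.ae_unique`); zero if there is none. -/
def weakDeriv (f : X → F) (v : X) : X → F :=
  if h : ∃ g : X → F, MemLp g 2 volume ∧ HasWeakDeriv f g v then h.choose else 0

theorem MemH1.weakDeriv_spec {f : X → F} (hf : MemH1 f) (v : X) :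
    MemLp (weakDeriv f v) 2 volume ∧ HasWeakDeriv f (weakDeriv f v) v := by
  have h := hf.2 v
  rw [weakDeriv, dif_pos h]
  exact h.choose_spec

theorem HasWeakDeriv.ae_unique [FiniteDimensional ℝ X] [BorelSpace X] [CompleteSpace F]
    [IsLocallyFiniteMeasure (volume : Measure X)]
    {f g g' : X → F} {v : X} (hg : MemLp g 2 volume) (hg' : MemLp g' 2 volume)
    (h : HasWeakDeriv f g v) (h' : HasWeakDeriv f g' v) : g =ᵐ[volume] g' := by
  refine ae_eq_of_integral_contDiff_smul_eq (hg.locallyIntegrable (by norm_num))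
    (hg'.locallyIntegrable (by norm_num)) ?_
  intro φ hφ hc
  exact neg_injective ((h φ hφ hc).symm.trans (h' φ hφ hc))

end Sobolev

/-! ### The model -/

/-- Physical space `ℝ³`. -/
abbrev E3 : Type := EuclideanSpace ℝ (Fin 3)

/-- Configuration space `ℝ^{3N} = (ℝ³)^N`, with Lebesgue measure. -/
abbrev Conf (N : ℕ) : Type := Fin N → E3

/-- The coordinate direction `e_a` of `ℝ³`. -/
def dir (a : Fin 3) : E3 := EuclideanSpace.single a 1

/-- The coordinate direction of `ℝ^{3N}` that moves the `a`-th coordinate of particle `i`. -/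
def confDir {N : ℕ} (i : Fin N) (a : Fin 3) : Conf N := Pi.single i (dir a)

/-- The Coulomb potential `V(x) = - ∑ₖ |x - yₖ|⁻¹`. -/
def coulomb {K : ℕ} (y : Fin K → E3) (x : E3) : ℝ := - ∑ k, ‖x - y k‖⁻¹

/-- The configuration with particle `i` at `x` and the other particles at `z`. -/
def insertAt {N : ℕ} (i : Fin N) (x : E3) (z : {j : Fin N // j ≠ i} → E3) : Conf N :=
  fun j => if h : j = i then x else z ⟨j, h⟩

/-- The one-particle density
`ρ_Ψ(x) = ∑ᵢ ∫_{ℝ^{3(N-1)}} |Ψ(x₁, …, x_{i-1}, x, x_{i+1}, …, x_N)|² ∏_{j ≠ i} dx_j`. -/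
def density {N : ℕ} (Ψ : Conf N → ℂ) (x : E3) : ℝ :=
  ∑ i : Fin N, ∫ z : {j : Fin N // j ≠ i} → E3, ‖Ψ (insertAt i x z)‖ ^ 2

/-- The `N`-body energy `ℰ_α(Ψ)`. -/
def manyBodyEnergy {N K : ℕ} (p α : ℝ) (y : Fin K → E3) (Ψ : Conf N → ℂ) : ℝ :=
  (∑ i : Fin N, ∫ X : Conf N,
    ((∑ a : Fin 3, ‖weakDeriv Ψ (confDir i a) X‖ ^ 2) + coulomb y (X i) * ‖Ψ X‖ ^ 2))
  - α ^ (2 * p - 2) / p * ∫ x : E3, density Ψ x ^ p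

/-- `Ψ ∈ H¹(ℝ^{3N}, ℂ)` is antisymmetric and normalized in `L²`. -/
structure IsFermionicState {N : ℕ} (Ψ : Conf N → ℂ) : Prop where
  memH1 : MemH1 Ψ
  antisymm : ∀ σ : Equiv.Perm (Fin N),
    ∀ᵐ X : Conf N, Ψ (fun j => X (σ j)) = ((Equiv.Perm.sign σ : ℤ) : ℂ) * Ψ X
  normalized : ∫ X : Conf N, ‖Ψ X‖ ^ 2 = 1

/-- The fermionic ground-state energy `E_f(N)`; the infimum is taken in `[-∞, ∞]`. -/
def fermionicEnergy (N : ℕ) {K : ℕ} (p α : ℝ) (y : Fin K → E3) : EReal :=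
  ⨅ Ψ ∈ {Ψ : Conf N → ℂ | IsFermionicState Ψ}, (manyBodyEnergy p α y Ψ : EReal)

/-- The energy `ℰ_α(u₁, …, u_N)` of an `N`-tuple of real functions. -/
def orbitalEnergy {N K : ℕ} (p α : ℝ) (y : Fin K → E3) (u : Fin N → E3 → ℝ) : ℝ :=
  (∑ i : Fin N, ∫ x : E3,
    ((∑ a : Fin 3, |weakDeriv (u i) (dir a) x| ^ 2) + coulomb y x * |u i x| ^ 2))
  - α ^ (2 * p - 2) / p * ∫ x : E3, (∑ i : Fin N, |u i x| ^ 2) ^ p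

/-- `u₁, …, u_N ∈ H¹(ℝ³, ℝ)` are orthonormal in `L²(ℝ³, ℝ)`. -/
structure IsOrthonormalTuple {N : ℕ} (u : Fin N → E3 → ℝ) : Prop where
  memH1 : ∀ i, MemH1 (u i)
  orthonormal : ∀ i j, ∫ x : E3, u i x * u j x = if i = j then 1 else 0

/-- The infimum `J_α(N)` over real orthonormal `N`-tuples; taken in `[-∞, ∞]`. -/
def orbitalInf (N : ℕ) {K : ℕ} (p α : ℝ) (y : Fin K → E3) : EReal :=
  ⨅ u ∈ {u : Fin N → E3 → ℝ | IsOrthonormalTuple u}, (orbitalEnergy p α y u : EReal)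

/-- The Slater determinant `(N!)^{-1/2} det (uᵢ(xⱼ))`. -/
def slaterDet {N : ℕ} (u : Fin N → E3 → ℂ) (X : Conf N) : ℂ :=
  ((Real.sqrt (Nat.factorial N) : ℝ) : ℂ)⁻¹ * (Matrix.of fun i j => u i (X j)).det

/-- `Ψ` is (almost everywhere equal to) the Slater determinant of an orthonormal `N`-tuple in
`L²(ℝ³, ℂ)`. -/
def IsSlater {N : ℕ} (Ψ : Conf N → ℂ) : Prop :=
  ∃ u : Fin N → E3 → ℂ, (∀ i, MemLp (u i) 2 volume) ∧
    (∀ i j, ∫ x : E3, u i x * (starRingEnd ℂ) (u j x) = if i = j then 1 else 0) ∧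
    Ψ =ᵐ[volume] slaterDet u

/-- The infimum of `ℰ_α` over the real-valued normalized Slater determinants in `H¹(ℝ^{3N})`;
taken in `[-∞, ∞]`. -/
def slaterInf (N : ℕ) {K : ℕ} (p α : ℝ) (y : Fin K → E3) : EReal :=
  ⨅ Ψ ∈ {Ψ : Conf N → ℂ | IsSlater Ψ ∧ MemH1 Ψ ∧ (∀ᵐ X : Conf N, (Ψ X).im = 0) ∧
      ∫ X : Conf N, ‖Ψ X‖ ^ 2 = 1},
    (manyBodyEnergy p α y Ψ : EReal)

end FermionicNLS

end

open MeasureTheory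
open scoped ContDiff

noncomputable section

namespace FermionicNLS

/-! ### The Sobolev inequality on `ℝ³` -/

section Mollification

open scoped Convolution

variable {X : Type*} [NormedAddCommGroup X] [NormedSpace ℝ X] [MeasureSpace X]
  [FiniteDimensional ℝ X] [BorelSpace X] [Measure.IsAddHaarMeasure (volume : Measure X)]

/-! The equalities come from the cycle `fermionicEnergy` ≤ `slaterInf` ≤ `orbitalInf` ≤
`fermionicEnergy`. The first inequality holds because determinants are antisymmetric. The second
holds because the determinant of a real orthonormal H¹ tuple has density Σ u_k² and the same kinetic
energy as the tuple, hence the same energy (`IsOrthonormalTuple.manyBodyEnergy_slaterDet`).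

The third carries the content. For a fermionic Ψ, view √N Ψ as a kernel between particle i₀ and the
others. Pairing it with L²(others, ℂ), taken as a real Hilbert space, gives a Hilbert–Schmidt
operator T into L²(ℝ³, ℝ) for which T T* is the real part of the one-particle density matrix. A
Hilbert basis b_j diagonalising T* T yields real, pairwise orthogonal orbitals v_j = T b_j with Σ
v_j² = ρ_Ψ and with the kinetic energy of Ψ as total kinetic energy
(`IsFermionicState.exists_natural_orbitals`). The Pauli principle
(`card_mul_integral_norm_sq_pairing_le`) gives n_j = ‖v_j‖² ≤ 1, and Σ n_j = N.

Since t ↦ t^p is convex, replacing the interaction by its tangent at ρ_Ψ bounds the orbital energy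
from above by a functional linear in the density. For a linear functional, fractional occupations
n_j ∈ [0, 1] of total N are no better, up to ε, than filling N states completely
(`exists_finset_card_sum_le`). The chosen normalised v_j form the required tuple
(`exists_orthonormalTuple_energy_le`).

All integrals are finite because ρ lies in L¹ ∩ L³: the Sobolev embedding H¹(ℝ³) ⊂ L⁶ is applied to
each v_j and summed. -/

theorem eLpNorm_two_convolution_le {φ g : X → ℝ} (hφ : Continuous φ) (hφ0 : ∀ x, 0 ≤ φ x)
    (hφi : Integrable φ) (hφ1 : ∫ x, φ x = 1) (hg : AEStronglyMeasurable g volume) :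
    eLpNorm (φ ⋆[ContinuousLinearMap.lsmul ℝ ℝ, volume] g) 2 volume ≤ eLpNorm g 2 volume := by
  set w : X → ENNReal := fun x => ENNReal.ofReal (φ x) with hw
  have hwm : Measurable w := hφ.measurable.ennreal_ofReal
  have hw1 : ∫⁻ x, w x = 1 := by
    rw [← ofReal_integral_eq_lintegral_ofReal hφi (Filter.Eventually.of_forall hφ0), hφ1]; simp
  have : IsProbabilityMeasure ((volume : Measure X).withDensity w) :=
    ⟨by rw [withDensity_apply _ MeasurableSet.univ]; simpa using hw1⟩
  have hgm : AEStronglyMeasurable (fun z : X × X => g (z.1 - z.2))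
      ((volume : Measure X).prod volume) :=
    hg.comp_quasiMeasurePreserving (quasiMeasurePreserving_sub_of_right_invariant volume volume)
  have hgx : ∀ x, AEStronglyMeasurable (fun t => g (x - t)) volume := fun x =>
    hg.comp_quasiMeasurePreserving (quasiMeasurePreserving_sub_left_of_right_invariant volume x)
  -- Jensen: φ dx is a probability measure and the convolution at x is an average of g(x - ·), so
  -- the L¹ norm of that translate is at most its L² norm.
  have key : ∀ x, ‖(φ ⋆[ContinuousLinearMap.lsmul ℝ ℝ, volume] g) x‖ₑ ^ (2:ℝ)
      ≤ ∫⁻ t, w t * ‖g (x - t)‖ₑ ^ (2:ℝ) := by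
    intro x
    have h1 : ‖(φ ⋆[ContinuousLinearMap.lsmul ℝ ℝ, volume] g) x‖ₑ
        ≤ eLpNorm (fun t => g (x - t)) 1 ((volume : Measure X).withDensity w) := by
      rw [eLpNorm_one_eq_lintegral_enorm,
        lintegral_withDensity_eq_lintegral_mul₀ hwm.aemeasurable (hgx x).enorm]
      refine (enorm_integral_le_lintegral_enorm _).trans (lintegral_mono fun t => ?_)
      simp only [ContinuousLinearMap.lsmul_apply, smul_eq_mul, enorm_mul, Pi.mul_apply, hw]
      rw [Real.enorm_of_nonneg (hφ0 t)]
    have h2 := eLpNorm_le_eLpNorm_of_exponent_le (μ := (volume : Measure X).withDensity w)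
      (p := 1) (q := 2) (by norm_num)
      ((hgx x).mono_ac (withDensity_absolutelyContinuous _ _))
    have h3 := h1.trans h2
    rw [eLpNorm_eq_lintegral_rpow_enorm_toReal (by norm_num) (by norm_num)] at h3
    calc _ ≤ _ := ENNReal.rpow_le_rpow h3 (by norm_num)
      _ = _ := by
        rw [← ENNReal.rpow_mul]
        norm_num
        rw [lintegral_withDensity_eq_lintegral_mul₀ hwm.aemeasurable ((hgx x).enorm.pow_const 2)]
        rfl
  have e2 : ∀ f : X → ℝ, eLpNorm f 2 volume = (∫⁻ x, ‖f x‖ₑ ^ (2:ℝ)) ^ (1 / (2:ℝ)) := fun f => by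
    rw [eLpNorm_eq_lintegral_rpow_enorm_toReal (by norm_num) (by norm_num)]; norm_num
  rw [e2, e2]
  refine ENNReal.rpow_le_rpow ?_ (by norm_num)
  calc ∫⁻ x, ‖(φ ⋆[ContinuousLinearMap.lsmul ℝ ℝ, volume] g) x‖ₑ ^ (2:ℝ)
      ≤ ∫⁻ x, ∫⁻ t, w t * ‖g (x - t)‖ₑ ^ (2:ℝ) := lintegral_mono key
    _ = ∫⁻ t, ∫⁻ x, w t * ‖g (x - t)‖ₑ ^ (2:ℝ) := by
        rw [lintegral_lintegral_swap]
        exact (hwm.comp measurable_snd).aemeasurable.mul (hgm.enorm.pow_const 2)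
    _ = ∫⁻ t, w t * ∫⁻ x, ‖g x‖ₑ ^ (2:ℝ) := by
        congr 1; ext t
        rw [lintegral_const_mul' _ _ ENNReal.ofReal_ne_top,
          lintegral_sub_right_eq_self (fun x => ‖g x‖ₑ ^ (2:ℝ)) t]
    _ = ∫⁻ x, ‖g x‖ₑ ^ (2:ℝ) := by
        rw [lintegral_mul_const _ hwm, hw1, one_mul]

/-- The derivative falls on the mollifier, and t ↦ φ(x - t) is a test function; the sign from the
reflection cancels the sign in `HasWeakDeriv`. -/
theorem HasWeakDeriv.fderiv_convolution {φ u g : X → ℝ} {v : X} (hφ : ContDiff ℝ ∞ φ)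
    (hc : HasCompactSupport φ) (hu : LocallyIntegrable u) (h : HasWeakDeriv u g v) (x : X) :
    fderiv ℝ (φ ⋆[ContinuousLinearMap.lsmul ℝ ℝ, volume] u) x v
      = (φ ⋆[ContinuousLinearMap.lsmul ℝ ℝ, volume] g) x := by
  have h1 : ContDiff ℝ 1 φ := hφ.of_le (by norm_cast)
  rw [(hc.hasFDerivAt_convolution_left _ h1 hu x).fderiv]
  have hex := (hc.fderiv ℝ).convolutionExists_left
    ((ContinuousLinearMap.lsmul ℝ ℝ : ℝ →L[ℝ] ℝ →L[ℝ] ℝ).precompL X)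
    (h1.continuous_fderiv one_ne_zero) hu x
  have hcomp : fderiv ℝ (fun t => φ (x - t)) = fun t => - fderiv ℝ φ (x - t) := by
    ext1 t
    have := ((h1.differentiable one_ne_zero (x - t)).hasFDerivAt.comp t
      ((hasFDerivAt_const x t).sub (hasFDerivAt_id t))).fderiv
    rw [show (fun t => φ (x - t)) = φ ∘ (fun t => x - t) from rfl]
    refine this.trans ?_
    ext z; simp
  have ht := h (fun t => φ (x - t)) (hφ.comp (contDiff_const.sub contDiff_id))
    (by simpa using! hc.comp_homeomorph (Homeomorph.subLeft x))
  rw [hcomp] at ht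
  simp only [convolution]
  rw [ContinuousLinearMap.integral_apply hex]
  simp only [ContinuousLinearMap.precompL_apply, ContinuousLinearMap.lsmul_apply, smul_eq_mul]
  simp only [neg_apply, smul_eq_mul, neg_mul, integral_neg, neg_inj] at ht
  rw [← integral_sub_left_eq_self _ _ x, ← integral_sub_left_eq_self (fun t => φ t * g (x - t)) _ x]
  simpa using ht

/-- A smooth compactly supported function is integrable against a locally integrable one. -/
theorem integrable_mul_of_hasCompactSupport {X : Type*} [NormedAddCommGroup X] [MeasureSpace X]
    [BorelSpace X] {φ u : X → ℝ} (hφ : Continuous φ)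
    (hc : HasCompactSupport φ) (hu : LocallyIntegrable u) : Integrable (fun x => φ x * u x) := by
  simpa using hu.integrable_smul_left_of_hasCompactSupport hφ hc

/-- Product rule: χ need not have compact support, since φ χ is a test function whenever φ is. -/
theorem HasWeakDeriv.mul_smooth {X : Type*} [NormedAddCommGroup X] [NormedSpace ℝ X]
    [MeasureSpace X] [BorelSpace X] {χ u g : X → ℝ} {v : X} (hχ : ContDiff ℝ ∞ χ)
    (hu : LocallyIntegrable u) (hg : LocallyIntegrable g)
    (h : HasWeakDeriv u g v) :
    HasWeakDeriv (fun x => χ x * u x) (fun x => χ x * g x + fderiv ℝ χ x v * u x) v := by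
  intro φ hφ hc
  have := h (fun x => φ x * χ x) (hφ.mul hχ) hc.mul_right
  have hd : ∀ x, fderiv ℝ (fun x => φ x * χ x) x v
      = φ x * fderiv ℝ χ x v + χ x * fderiv ℝ φ x v := by
    intro x
    rw [fderiv_fun_mul (hφ.differentiable (by simp) x) (hχ.differentiable (by simp) x)]
    simp
  have c1 : Continuous fun x => fderiv ℝ χ x v :=
    (hχ.continuous_fderiv (by simp)).clm_apply continuous_const
  have c2 : Continuous fun x => fderiv ℝ φ x v :=
    (hφ.continuous_fderiv (by simp)).clm_apply continuous_const
  have k2 : HasCompactSupport fun x => fderiv ℝ φ x v := hc.fderiv_apply ℝ v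
  have i1 : Integrable fun x => (φ x * fderiv ℝ χ x v) * u x :=
    integrable_mul_of_hasCompactSupport (hφ.continuous.mul c1) hc.mul_right hu
  have i2 : Integrable fun x => (χ x * fderiv ℝ φ x v) * u x :=
    integrable_mul_of_hasCompactSupport (hχ.continuous.mul c2) k2.mul_left hu
  have i3 : Integrable fun x => (φ x * χ x) * g x :=
    integrable_mul_of_hasCompactSupport (hφ.continuous.mul hχ.continuous) hc.mul_right hg
  simp only [hd, smul_eq_mul, add_mul] at this ⊢
  rw [integral_add i1 i2] at this
  have e : ∀ x, φ x * (χ x * g x + fderiv ℝ χ x v * u x)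
      = (φ x * χ x) * g x + (φ x * fderiv ℝ χ x v) * u x := fun x => by ring
  simp only [e]
  rw [integral_add i3 i1, ← sub_eq_zero]
  have e2 : ∀ x, fderiv ℝ φ x v * (χ x * u x) = χ x * fderiv ℝ φ x v * u x := fun x => by ring
  simp only [e2]
  linarith

end Mollification

open scoped Convolution

theorem norm_le_sum_dir (L : E3 →L[ℝ] ℝ) : ‖L‖ ≤ ∑ a, ‖L (dir a)‖ := by
  refine L.opNorm_le_bound (by positivity) fun x => ?_
  have hx : x = ∑ a, x a • dir a := by
    have := (EuclideanSpace.basisFun (Fin 3) ℝ).sum_repr x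
    simpa [dir] using this.symm
  conv_lhs => rw [hx]
  rw [map_sum, Finset.sum_mul]
  refine (norm_sum_le _ _).trans (Finset.sum_le_sum fun a _ => ?_)
  rw [map_smul, norm_smul, mul_comm]
  gcongr
  exact PiLp.norm_apply_le x a

/-- The Gagliardo–Nirenberg–Sobolev inequality for compactly supported weakly differentiable
functions. -/
theorem exists_eLpNorm_six_le_of_hasCompactSupport : ∃ C : NNReal, ∀ (u : E3 → ℝ) (g : Fin 3 → E3 → ℝ),
    HasCompactSupport u → MemLp u 2 volume → (∀ a, MemLp (g a) 2 volume) →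
    (∀ a, HasWeakDeriv u (g a) (dir a)) →
    eLpNorm u 6 volume ≤ C * ∑ a, eLpNorm (g a) 2 volume := by
  refine ⟨eLpNormLESNormFDerivOfEqInnerConst (volume : Measure E3) 2, ?_⟩
  intro u g hc hu hg hw
  -- The outer radius is exactly twice the inner one; this bounded ratio gives a.e. convergence of
  -- the mollifications of a merely locally integrable u.
  let φ : ℕ → ContDiffBump (0 : E3) := fun n =>
    ⟨1 / ((n : ℝ) + 1), 2 * (1 / ((n : ℝ) + 1)), by positivity, by
      have : 0 < 1 / ((n : ℝ) + 1) := by positivity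
      linarith⟩
  have hφ : Filter.Tendsto (fun i => (φ i).rOut) Filter.atTop (nhds 0) := by
    simpa [φ] using (tendsto_one_div_add_atTop_nhds_zero_nat (𝕜 := ℝ)).const_mul 2
  have hul : LocallyIntegrable u := hu.locallyIntegrable (by norm_num)
  have hlim := ContDiffBump.ae_convolution_tendsto_right_of_locallyIntegrable (μ := volume)
    (K := 2) hφ (Filter.Eventually.of_forall fun i => le_rfl) hul
  set w : ℕ → E3 → ℝ := fun n =>
    ((φ n).normed volume ⋆[ContinuousLinearMap.lsmul ℝ ℝ, volume] u) with hwdef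
  have hsm : ∀ n, ContDiff ℝ 1 (w n) := fun n =>
    (φ n).hasCompactSupport_normed.contDiff_convolution_left _ (φ n).contDiff_normed hul
  -- Fatou: it suffices to bound the L⁶ norm of every mollification by the same constant.
  refine (Lp.eLpNorm_lim_le_liminf_eLpNorm (fun n => (hsm n).continuous.aestronglyMeasurable)
    u hlim).trans ?_
  refine Filter.liminf_le_of_frequently_le' (Filter.Frequently.of_forall fun n => ?_)
  have hsob := eLpNorm_le_eLpNorm_fderiv_of_eq_inner (volume : Measure E3) (p := 2) (p' := 6) (hsm n)
    ((φ n).hasCompactSupport_normed.convolution _ hc) (by norm_num) (by simp)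
    (by simp; norm_num)
  refine hsob.trans (mul_le_mul' (le_of_eq (by norm_num)) ?_)
  have hd : ∀ x, ‖fderiv ℝ (w n) x‖ ≤
      ‖∑ a, |((φ n).normed volume ⋆[ContinuousLinearMap.lsmul ℝ ℝ, volume] (g a)) x|‖ := by
    intro x
    rw [Real.norm_of_nonneg (by positivity)]
    refine (norm_le_sum_dir _).trans (le_of_eq (Finset.sum_congr rfl fun a _ => ?_))
    rw [Real.norm_eq_abs, (hw a).fderiv_convolution (φ n).contDiff_normed
      (φ n).hasCompactSupport_normed hul]
  have hm : ∀ a, AEStronglyMeasurable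
      ((φ n).normed volume ⋆[ContinuousLinearMap.lsmul ℝ ℝ, volume] (g a)) volume := fun a =>
    ((φ n).hasCompactSupport_normed.contDiff_convolution_left (n := 1) _ (φ n).contDiff_normed
      ((hg a).locallyIntegrable (by norm_num))).continuous.aestronglyMeasurable
  refine (eLpNorm_mono hd).trans ?_
  have : (fun x => ∑ a, |((φ n).normed volume ⋆[ContinuousLinearMap.lsmul ℝ ℝ, volume] (g a)) x|)
    = ∑ a, fun x => |((φ n).normed volume ⋆[ContinuousLinearMap.lsmul ℝ ℝ, volume] (g a)) x| := by
    ext x; simp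
  rw [this]
  refine (eLpNorm_sum_le (fun a _ => (hm a).norm) (by norm_num)).trans ?_
  refine Finset.sum_le_sum fun a _ => ?_
  refine (eLpNorm_norm _).le.trans ?_
  exact eLpNorm_two_convolution_le (φ n).continuous_normed (φ n).nonneg_normed
    (φ n).integrable_normed (φ n).integral_normed (hg a).1

/-- The Sobolev inequality for `H¹(ℝ³)`. -/
theorem exists_eLpNorm_six_le : ∃ C : NNReal, ∀ (u : E3 → ℝ) (g : Fin 3 → E3 → ℝ),
    MemLp u 2 volume → (∀ a, MemLp (g a) 2 volume) → (∀ a, HasWeakDeriv u (g a) (dir a)) →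
    eLpNorm u 6 volume ≤ C * (eLpNorm u 2 volume + ∑ a, eLpNorm (g a) 2 volume) := by
  obtain ⟨C, hC⟩ := exists_eLpNorm_six_le_of_hasCompactSupport
  let χ : ContDiffBump (0 : E3) := ⟨1, 2, by norm_num, by norm_num⟩
  obtain ⟨M, hM⟩ := (χ.hasCompactSupport.fderiv ℝ).exists_bound_of_continuous
    ((χ.contDiff (n := 1)).continuous_fderiv one_ne_zero)
  have hM0 : 0 ≤ M := (norm_nonneg _).trans (hM 0)
  -- Cut off by χ(x/(n+1)), whose partial derivatives are bounded by M uniformly in n. Each of the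
  -- three directions contributes M‖u‖₂, and the 1 absorbs the terms χ ∂u.
  refine ⟨C * (3 * M.toNNReal + 1), fun u g hu hg hw => ?_⟩
  set s : ℕ → E3 → E3 := fun n x => ((n : ℝ) + 1)⁻¹ • x with hs
  set w : ℕ → E3 → ℝ := fun n x => χ (s n x) * u x with hwdef
  have hcn : ∀ n, ContDiff ℝ ∞ (fun x => χ (s n x)) := fun n =>
    χ.contDiff.comp (contDiff_id.const_smul _)
  have hcs : ∀ n, HasCompactSupport (fun x => χ (s n x)) := fun n =>
    χ.hasCompactSupport.comp_smul (by positivity)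
  have hchi : ∀ n x, |χ (s n x)| ≤ 1 := fun n x => by
    rw [abs_of_nonneg χ.nonneg]; exact χ.le_one
  have hder : ∀ n x a, |fderiv ℝ (fun x => χ (s n x)) x (dir a)| ≤ M := by
    intro n x a
    have : fderiv ℝ (fun x => χ (s n x)) x (dir a)
        = ((n : ℝ) + 1)⁻¹ * fderiv ℝ χ (s n x) (dir a) := by
      have h1 : HasFDerivAt (s n) (((n : ℝ) + 1)⁻¹ • ContinuousLinearMap.id ℝ E3) x :=
        (hasFDerivAt_id (𝕜 := ℝ) x).const_smul (((n : ℝ) + 1)⁻¹)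
      have h2 := ((χ.contDiff (n := 1)).differentiable one_ne_zero (s n x)).hasFDerivAt.comp x h1
      rw [show (fun x => χ (s n x)) = χ ∘ s n from rfl, h2.fderiv]
      simp
    rw [this, abs_mul, abs_of_nonneg (by positivity)]
    have h3 : |fderiv ℝ χ (s n x) (dir a)| ≤ M := by
      refine ((fderiv ℝ χ (s n x)).le_opNorm (dir a)).trans ?_
      simpa [dir] using hM (s n x)
    have h4 : ((n : ℝ) + 1)⁻¹ ≤ 1 := inv_le_one_of_one_le₀ (by linarith [n.cast_nonneg (α := ℝ)])
    calc _ ≤ 1 * M := mul_le_mul h4 h3 (abs_nonneg _) zero_le_one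
      _ = M := one_mul M
  have hul : LocallyIntegrable u := hu.locallyIntegrable (by norm_num)
  have hgl : ∀ a, LocallyIntegrable (g a) := fun a => (hg a).locallyIntegrable (by norm_num)
  have hlim : ∀ x, Filter.Tendsto (fun n => w n x) Filter.atTop (nhds (u x)) := by
    intro x
    have h1 : Filter.Tendsto (fun n => s n x) Filter.atTop (nhds 0) := by
      have := (tendsto_one_div_add_atTop_nhds_zero_nat (𝕜 := ℝ)).smul_const x
      simpa [hs] using this
    have h2 := (χ.continuous.tendsto 0).comp h1
    rw [χ.one_of_mem_closedBall (by simp [χ])] at h2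
    simpa using h2.mul_const (u x)
  have hm1 : ∀ n, MemLp (w n) 2 volume := fun n => by
    refine hu.of_le ((hcn n).continuous.aestronglyMeasurable.mul hu.1)
      (Filter.Eventually.of_forall fun x => ?_)
    rw [norm_mul]
    exact mul_le_of_le_one_left (norm_nonneg _) (hchi n x)
  have hA : ∀ n a, AEStronglyMeasurable (fun x => χ (s n x) * g a x) volume := fun n a =>
    (hcn n).continuous.aestronglyMeasurable.mul (hg a).1
  have hB : ∀ n a, AEStronglyMeasurable
      (fun x => fderiv ℝ (fun x => χ (s n x)) x (dir a) * u x) volume := fun n a =>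
    (((hcn n).continuous_fderiv (by simp)).clm_apply
      continuous_const).aestronglyMeasurable.mul hu.1
  have hA' : ∀ n a, MemLp (fun x => χ (s n x) * g a x) 2 volume := fun n a =>
    (hg a).of_le (hA n a) (Filter.Eventually.of_forall fun x => by
      rw [norm_mul]; exact mul_le_of_le_one_left (norm_nonneg _) (hchi n x))
  have hBle : ∀ n a x, ‖fderiv ℝ (fun x => χ (s n x)) x (dir a) * u x‖ ≤ M * ‖u x‖ :=
    fun n a x => by
      rw [norm_mul]; exact mul_le_mul_of_nonneg_right (hder n x a) (norm_nonneg _)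
  have hB' : ∀ n a, MemLp (fun x => fderiv ℝ (fun x => χ (s n x)) x (dir a) * u x) 2 volume :=
    fun n a => hu.of_le_mul (hB n a) (Filter.Eventually.of_forall (hBle n a))
  refine (Lp.eLpNorm_lim_le_liminf_eLpNorm (fun n => (hm1 n).1) u
    (Filter.Eventually.of_forall hlim)).trans ?_
  refine Filter.liminf_le_of_frequently_le' (Filter.Frequently.of_forall fun n => ?_)
  refine (hC (w n) _ (hcs n).mul_right (hm1 n) (fun a => (hA' n a).add (hB' n a))
    (fun a => (hw a).mul_smooth (hcn n) hul (hgl a))).trans ?_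
  rw [ENNReal.coe_mul, mul_assoc]
  gcongr
  have hsum : ∀ a, eLpNorm ((fun x => χ (s n x) * g a x)
      + (fun x => fderiv ℝ (fun x => χ (s n x)) x (dir a) * u x)) 2 volume
      ≤ eLpNorm (g a) 2 volume + M.toNNReal * eLpNorm u 2 volume := by
    intro a
    refine (eLpNorm_add_le (hA n a) (hB n a) (by norm_num)).trans (add_le_add ?_ ?_)
    · exact eLpNorm_mono fun x => by
        rw [norm_mul]; exact mul_le_of_le_one_left (norm_nonneg _) (hchi n x)
    · refine (eLpNorm_le_nnreal_smul_eLpNorm_of_ae_le_mul (c := M.toNNReal)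
        (Filter.Eventually.of_forall fun x => ?_) 2).trans (le_of_eq (by rfl))
      have := hBle n a x
      rw [← NNReal.coe_le_coe]
      simpa [Real.coe_toNNReal M hM0] using this
  refine (Finset.sum_le_sum fun a _ => hsum a).trans ?_
  rw [Finset.sum_add_distrib]
  simp only [Finset.sum_const, Finset.card_univ, Fintype.card_fin, nsmul_eq_mul]
  push_cast
  rw [add_mul, one_mul, mul_add]
  calc _ ≤ (∑ a, eLpNorm (g a) 2 volume + 3 * (M.toNNReal * eLpNorm u 2 volume))
        + (3 * M.toNNReal * ∑ a, eLpNorm (g a) 2 volume + eLpNorm u 2 volume) := le_self_add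
    _ = _ := by ring

/-! ### Integrability of the potential and interaction terms -/

/-- In polar coordinates the radial integrand is r² r^(-3/2) = r^(1/2). -/
theorem integrableOn_norm_rpow_neg_ball :
    IntegrableOn (fun x : E3 => ‖x‖ ^ (-(3 / 2) : ℝ)) (Metric.ball 0 1) := by
  rw [integrableOn_fun_norm_addHaar (f := fun r : ℝ => r ^ (-(3 / 2) : ℝ)) (volume : Measure E3)]
  have h : IntegrableOn (fun y : ℝ => y ^ (1 / 2 : ℝ)) (Set.Ioo 0 1) :=
    (intervalIntegral.integrableOn_Ioo_rpow_iff zero_lt_one).2 (by norm_num)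
  refine h.congr_fun (fun y hy => ?_) measurableSet_Ioo
  simp only [finrank_euclideanSpace, Fintype.card_fin, smul_eq_mul]
  rw [← Real.rpow_natCast, ← Real.rpow_add hy.1]
  norm_num

/-- Either b ≤ √a, so ab ≤ a^(3/2), or a ≤ b², so ab ≤ b³. The exponents are chosen so that
|x|^(-3/2) is locally integrable on ℝ³ and ρ³ is what Sobolev controls. -/
theorem mul_le_rpow_add_cube {a b : ℝ} (ha : 0 ≤ a) (hb : 0 ≤ b) :
    a * b ≤ a ^ (3 / 2 : ℝ) + b ^ 3 := by
  have h1 : 0 ≤ a ^ (3 / 2 : ℝ) := Real.rpow_nonneg ha _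
  have e : a ^ (3 / 2 : ℝ) = a * √a := by
    rw [Real.sqrt_eq_rpow, ← Real.rpow_one_add' ha (by norm_num)]; norm_num
  rcases le_total b √a with h | h
  · rw [e]; nlinarith [mul_le_mul_of_nonneg_left h ha, pow_nonneg hb 3]
  · have : a ≤ b ^ 2 := (Real.sqrt_le_left hb).1 h
    nlinarith [mul_le_mul_of_nonneg_right this hb]

/-- Inside the unit ball around y the product is split by `mul_le_rpow_add_cube`; outside it is at
most ρ. -/
theorem integrable_inv_norm_sub_mul {ρ : E3 → ℝ} (h0 : ∀ x, 0 ≤ ρ x) (h1 : Integrable ρ)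
    (h3 : Integrable fun x => ρ x ^ 3) (y : E3) : Integrable fun x => ‖x - y‖⁻¹ * ρ x := by
  have hi : Integrable ((Metric.ball 0 1).indicator fun x : E3 => ‖x‖ ^ (-(3 / 2) : ℝ)) :=
    (integrable_indicator_iff measurableSet_ball).2 integrableOn_norm_rpow_neg_ball
  refine Integrable.mono' ((h1.add h3).add (hi.comp_sub_right y)) ?_
    (Filter.Eventually.of_forall fun x => ?_)
  · exact (by fun_prop : Measurable fun x : E3 => ‖x - y‖⁻¹).aestronglyMeasurable.mul h1.1
  · have hρ3 := pow_nonneg (h0 x) 3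
    rw [Real.norm_of_nonneg (mul_nonneg (by positivity) (h0 x))]
    simp only [Pi.add_apply]
    by_cases hx : x - y ∈ Metric.ball (0 : E3) 1
    · rw [Set.indicator_of_mem hx]
      have := mul_le_rpow_add_cube (a := ‖x - y‖⁻¹) (b := ρ x) (by positivity) (h0 x)
      rw [Real.inv_rpow (norm_nonneg _), ← Real.rpow_neg (norm_nonneg _)] at this
      linarith [h0 x]
    · rw [Set.indicator_of_notMem hx]
      have hx' : 1 ≤ ‖x - y‖ := by simpa using hx
      have := mul_le_mul_of_nonneg_right (inv_le_one_of_one_le₀ hx') (h0 x)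
      linarith

theorem integrable_coulomb_mul {K : ℕ} (y : Fin K → E3) {ρ : E3 → ℝ} (h0 : ∀ x, 0 ≤ ρ x)
    (h1 : Integrable ρ) (h3 : Integrable fun x => ρ x ^ 3) :
    Integrable fun x => coulomb y x * ρ x := by
  have : (fun x => coulomb y x * ρ x) = fun x => - ∑ k, ‖x - y k‖⁻¹ * ρ x := by
    ext x; rw [coulomb, neg_mul, Finset.sum_mul]
  rw [this]
  exact (integrable_finsetSum _ fun k _ => integrable_inv_norm_sub_mul h0 h1 h3 (y k)).neg

/-- Interpolation in its crudest form: ρ^p ≤ ρ + ρ³, by comparing exponents according to whether ρ ≤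
1. -/
theorem integrable_rpow {ρ : E3 → ℝ} (h0 : ∀ x, 0 ≤ ρ x) (h1 : Integrable ρ)
    (h3 : Integrable fun x => ρ x ^ 3) {p : ℝ} (hp : 1 ≤ p) (hp3 : p ≤ 3) :
    Integrable fun x => ρ x ^ p := by
  refine Integrable.mono' (h1.add h3) (h1.1.aemeasurable.pow_const p).aestronglyMeasurable
    (Filter.Eventually.of_forall fun x => ?_)
  rw [Real.norm_of_nonneg (Real.rpow_nonneg (h0 x) p)]
  simp only [Pi.add_apply]
  rcases le_total (ρ x) 1 with h | h
  · rcases (h0 x).eq_or_lt with h' | h'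
    · rw [← h', Real.zero_rpow (by linarith)]; norm_num
    · have := Real.rpow_le_rpow_of_exponent_ge h' h hp
      rw [Real.rpow_one] at this
      linarith [pow_nonneg (h0 x) 3]
  · have := Real.rpow_le_rpow_of_exponent_le h hp3
    rw [show (3 : ℝ) = ((3 : ℕ) : ℝ) by norm_num, Real.rpow_natCast] at this
    linarith [h0 x]

theorem integrable_pow_six_of_memLp {u : E3 → ℝ} (h : MemLp u 6 volume) :
    Integrable fun x => (u x ^ 2) ^ 3 := by
  have := h.integrable_norm_pow (p := 6) (by norm_num)
  refine this.congr (Filter.Eventually.of_forall fun x => ?_)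
  have : ‖u x‖ ^ 2 = u x ^ 2 := by simp
  calc ‖u x‖ ^ 6 = (‖u x‖ ^ 2) ^ 3 := by ring
    _ = _ := by rw [this]

theorem MemH1.memLp_six {u : E3 → ℝ} (hu : MemH1 u) : MemLp u 6 volume := by
  obtain ⟨C, hC⟩ := exists_eLpNorm_six_le
  refine ⟨hu.1.1, (hC u (fun a => weakDeriv u (dir a)) hu.1 (fun a => (hu.weakDeriv_spec _).1)
    (fun a => (hu.weakDeriv_spec _).2)).trans_lt ?_⟩
  refine ENNReal.mul_lt_top ENNReal.coe_lt_top (ENNReal.add_lt_top.2 ⟨hu.1.2, ?_⟩)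
  exact ENNReal.sum_lt_top.2 fun a _ => (hu.weakDeriv_spec _).1.2

theorem eLpNorm_three_sq (v : E3 → ℝ) :
    eLpNorm (fun x => v x ^ 2) 3 volume = eLpNorm v 6 volume ^ 2 := by
  have := eLpNorm_norm_rpow (μ := (volume : Measure E3)) (p := 3) v (q := 2) (by norm_num)
  rw [show (3 : ENNReal) * ENNReal.ofReal 2 = 6 by
    rw [ENNReal.ofReal_ofNat]; norm_num] at this
  rw [← ENNReal.rpow_natCast]
  push_cast
  rw [← this]
  congr 1
  ext x
  simp

/-- An `L⁶`-square-summable superposition of densities has finite `L³` norm. -/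
theorem integrable_cube_of_hasSum {ι : Type*} [Countable ι] {v : ι → E3 → ℝ} {ρ : E3 → ℝ}
    (hv : ∀ j, MemLp (v j) 6 volume) (hs : ∀ᵐ x, HasSum (fun j => v j x ^ 2) (ρ x))
    (hB : ∑' j, eLpNorm (v j) 6 volume ^ 2 ≠ ⊤) (hρ : AEStronglyMeasurable ρ volume) :
    Integrable fun x => ρ x ^ 3 := by
  -- Fatou needs a sequence; for countable ι the filter `atTop` on finite sets admits one.
  obtain ⟨s, hsq⟩ := Filter.exists_seq_tendsto (Filter.atTop : Filter (Finset ι))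
  have hm : ∀ j, AEStronglyMeasurable (fun x => v j x ^ 2) volume := fun j => (hv j).1.pow 2
  have hlim : ∀ᵐ x, Filter.Tendsto (fun n => (∑ j ∈ s n, fun x => v j x ^ 2) x) Filter.atTop
      (nhds (ρ x)) := by
    filter_upwards [hs] with x hx
    have := Filter.Tendsto.comp hx hsq
    simpa [Function.comp_def, Finset.sum_apply] using this
  -- Triangle inequality in L³ with ‖v²‖₃ = ‖v‖₆² for the finite sums, then Fatou.
  have hle : eLpNorm ρ 3 volume ≤ ∑' j, eLpNorm (v j) 6 volume ^ 2 := by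
    refine (Lp.eLpNorm_lim_le_liminf_eLpNorm
      (fun n => Finset.aestronglyMeasurable_sum _ fun j _ => hm j) ρ hlim).trans ?_
    refine Filter.liminf_le_of_frequently_le' (Filter.Frequently.of_forall fun n => ?_)
    refine (eLpNorm_sum_le (fun j _ => hm j) (by norm_num)).trans ?_
    simp only [eLpNorm_three_sq]
    exact ENNReal.sum_le_tsum _
  have hρ3 : MemLp ρ 3 volume := ⟨hρ, hle.trans_lt hB.lt_top⟩
  refine (hρ3.integrable_norm_pow (p := 3) (by norm_num)).congr ?_
  filter_upwards [hs] with x hx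
  rw [Real.norm_of_nonneg (hx.nonneg fun j => sq_nonneg _)]

/-! ### Hilbert–Schmidt operators -/

section Abstract

variable {H H' : Type*} [NormedAddCommGroup H] [InnerProductSpace ℝ H]
  [NormedAddCommGroup H'] [InnerProductSpace ℝ H']

/-- Distinct members lie at distance √2, so balls of radius 1/2 are disjoint. Countability is needed
later to exchange sums and integrals. -/
theorem Orthonormal.countable_index [TopologicalSpace.SeparableSpace H] {ι : Type*} {v : ι → H}
    (hv : Orthonormal ℝ v) : Countable ι := by
  have hd : Pairwise (Function.onFun Disjoint fun i => Metric.ball (v i) (1 / 2)) := by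
    intro i j hij
    refine Metric.ball_disjoint_ball ?_
    have h : dist (v i) (v j) ^ 2 = 2 := by
      rw [dist_eq_norm, @norm_sub_sq_real, hv.1 i, hv.1 j, hv.2 hij]; norm_num
    nlinarith [dist_nonneg (x := v i) (y := v j)]
  have := Set.PairwiseDisjoint.countable_of_isOpen (s := fun i => Metric.ball (v i) (1 / 2))
    (a := Set.univ) (fun i _ j _ hij => hd hij) (fun i _ => Metric.isOpen_ball)
    (fun i _ => ⟨v i, Metric.mem_ball_self (by norm_num)⟩)
  exact Set.countable_univ_iff.1 this

/-- The finite-rank truncations converge in operator norm: Cauchy–Schwarz bounds a tail by Bessel's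
inequality for x times the tail of Σ‖T b_j‖². -/
theorem isCompactOperator_of_summable_norm_sq [CompleteSpace H'] {ι : Type*}
    (b : HilbertBasis ι ℝ H) (T : H →L[ℝ] H') (hs : Summable fun j => ‖T (b j)‖ ^ 2) :
    IsCompactOperator T := by
  classical
  let S : ι → H →L[ℝ] H' := fun j =>
    (ContinuousLinearMap.toSpanSingleton ℝ (T (b j))).comp (innerSL ℝ (b j))
  have hS : ∀ j x, S j x = inner ℝ (b j) x • T (b j) := fun j x => by simp [S]
  have hSc : ∀ j, S j ∈ compactOperator (RingHom.id ℝ) H H' := fun j =>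
    (isCompactOperator_of_locallyCompactSpace_rng
      (ContinuousLinearMap.toSpanSingleton ℝ (T (b j)))).comp_clm (innerSL ℝ (b j))
  refine isCompactOperator_of_tendsto (l := Filter.atTop) (F := fun J : Finset ι => ∑ j ∈ J, S j)
    ?_ (Filter.Eventually.of_forall fun J => Submodule.sum_mem _ fun j _ => hSc j)
  rw [Metric.tendsto_atTop]
  intro ε hε
  obtain ⟨J₀, hJ₀⟩ := summable_iff_vanishing_norm.1 hs ((ε / 2) ^ 2) (by positivity)
  refine ⟨J₀, fun J hJ => ?_⟩
  have hle : ‖∑ j ∈ J, S j - T‖ ≤ ε / 2 := by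
    refine ContinuousLinearMap.opNorm_le_bound _ (by positivity) fun x => ?_
    have hx : HasSum (fun j => S j x) (T x) := by
      have := (b.hasSum_repr x).mapL T
      simpa [hS, b.repr_apply_apply] using this
    have hlim : Filter.Tendsto (fun K : Finset ι => ‖∑ j ∈ J, S j x - ∑ j ∈ K, S j x‖)
        Filter.atTop (nhds ‖∑ j ∈ J, S j x - T x‖) := (tendsto_const_nhds.sub hx).norm
    have heq : (∑ j ∈ J, S j - T) x = ∑ j ∈ J, S j x - T x := by simp
    rw [heq]
    refine le_of_tendsto hlim ?_
    filter_upwards [Filter.eventually_ge_atTop J] with K hK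
    rw [norm_sub_rev, ← Finset.sum_sdiff hK, add_sub_cancel_right]
    have hdis : Disjoint (K \ J) J₀ := Finset.disjoint_of_subset_right hJ Finset.sdiff_disjoint
    have h1 := hJ₀ _ hdis
    rw [Real.norm_of_nonneg (Finset.sum_nonneg fun j _ => sq_nonneg _)] at h1
    have h2 : ∑ j ∈ K \ J, |inner ℝ (b j) x| ^ 2 ≤ ‖x‖ ^ 2 := by
      simpa using b.orthonormal.sum_inner_products_le x (s := K \ J)
    have h3 : ‖∑ j ∈ K \ J, S j x‖ ≤ ∑ j ∈ K \ J, |inner ℝ (b j) x| * ‖T (b j)‖ :=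
      (norm_sum_le _ _).trans (le_of_eq (Finset.sum_congr rfl fun j _ => by
        rw [hS, norm_smul, Real.norm_eq_abs]))
    have h4 := Finset.sum_mul_sq_le_sq_mul_sq (K \ J) (fun j => |inner ℝ (b j) x|)
      (fun j => ‖T (b j)‖)
    refine h3.trans (abs_le_of_sq_le_sq' ?_ (by positivity)).2
    calc _ ≤ _ := h4
      _ ≤ ‖x‖ ^ 2 * (ε / 2) ^ 2 := mul_le_mul h2 h1.le (by positivity) (by positivity)
      _ = _ := by ring
  rw [dist_eq_norm]
  linarith

/-- The spectral theorem for compact symmetric operators, in the form of a Hilbert basis of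
eigenvectors. -/
theorem exists_hilbertBasis_eigenvectors.{u} {H : Type u} [NormedAddCommGroup H]
    [InnerProductSpace ℝ H] [CompleteSpace H] {T : H →L[ℝ] H} (hT : IsCompactOperator T)
    (hs : (T : H →ₗ[ℝ] H).IsSymmetric) :
    ∃ (ι : Type u) (b : HilbertBasis ι ℝ H) (n : ι → ℝ), ∀ j, T (b j) = n j • b j := by
  classical
  let V : ℝ → Submodule ℝ H := fun μ => Module.End.eigenspace (T : Module.End ℝ H) μ
  have hV : OrthogonalFamily ℝ (fun μ => V μ) fun μ => (V μ).subtypeₗᵢ :=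
    hs.orthogonalFamily_eigenspaces
  have hcl : ∀ μ, IsClosed (V μ : Set H) := by
    intro μ
    have : (V μ : Set H) = {x | T x = μ • x} := by
      ext x; simp [V]
    rw [this]
    exact isClosed_eq T.continuous (continuous_const_smul μ)
  have hc : ∀ μ, CompleteSpace (V μ) := fun μ => (hcl μ).completeSpace_coe
  choose w B hB using fun μ => exists_hilbertBasis ℝ (V μ)
  have hon := hV.orthonormal_sigma_orthonormal (fun μ => (B μ).orthonormal)
  -- A vector orthogonal to the chosen basis of every eigenspace, the kernel (μ = 0) included, is
  -- orthogonal to all eigenspaces, whose span has trivial complement.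
  have hbot : (Submodule.span ℝ (Set.range fun a : Σ μ, w μ => (V a.1).subtypeₗᵢ (B a.1 a.2)))ᗮ
      = ⊥ := by
    rw [eq_bot_iff, ← ContinuousLinearMap.orthogonalComplement_iSup_eigenspaces_eq_bot hT hs]
    intro x hx
    rw [Submodule.mem_orthogonal] at hx
    have : (⨆ μ, V μ) ≤ (ℝ ∙ x)ᗮ := by
      refine iSup_le fun μ z hz => ?_
      rw [Submodule.mem_orthogonal_singleton_iff_inner_right]
      have h1 := ((B μ).hasSum_repr ⟨z, hz⟩).mapL (V μ).subtypeL
      have h2 := h1.mapL (innerSL ℝ x)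
      have h3 : ∀ j, inner ℝ x ((B μ j : V μ) : H) = 0 := fun j => by
        rw [real_inner_comm]
        exact hx _ (Submodule.subset_span ⟨⟨μ, j⟩, rfl⟩)
      simp only [map_smul, Submodule.subtypeL_apply, innerSL_apply_apply, h3, smul_zero] at h2
      exact (h2.unique hasSum_zero)
    rw [Submodule.mem_orthogonal]
    intro u hu
    have := (Submodule.mem_orthogonal_singleton_iff_inner_right.1 (this hu))
    rw [real_inner_comm]; exact this
  refine ⟨Σ μ, w μ, HilbertBasis.mkOfOrthogonalEqBot hon hbot, fun a => a.1, fun a => ?_⟩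
  rw [HilbertBasis.coe_mkOfOrthogonalEqBot]
  exact Module.End.mem_eigenspace_iff.1 (B a.1 a.2).2

/-- Singular value decomposition of a Hilbert–Schmidt operator. -/
theorem exists_hilbertBasis_orthogonal_image.{u} {H : Type u} [NormedAddCommGroup H]
    [InnerProductSpace ℝ H] [CompleteSpace H] [CompleteSpace H'] {T : H →L[ℝ] H'}
    (hT : IsCompactOperator T) :
    ∃ (ι : Type u) (b : HilbertBasis ι ℝ H), ∀ i j, i ≠ j → inner ℝ (T (b i)) (T (b j)) = 0 := by
  -- The basis diagonalises T*T: ⟨T b_i, T b_j⟩ = ⟨b_i, T*T b_j⟩ = n_j ⟨b_i, b_j⟩.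
  have hc : IsCompactOperator (T.adjoint.comp T) := (hT.clm_comp T.adjoint :)
  have hs : ((T.adjoint.comp T : H →L[ℝ] H) : H →ₗ[ℝ] H).IsSymmetric := by
    intro x y
    simp [ContinuousLinearMap.adjoint_inner_left, ContinuousLinearMap.adjoint_inner_right]
  obtain ⟨ι, b, n, hn⟩ := exists_hilbertBasis_eigenvectors hc hs
  refine ⟨ι, b, fun i j hij => ?_⟩
  rw [← ContinuousLinearMap.adjoint_inner_right]
  have := hn j
  rw [ContinuousLinearMap.comp_apply] at this
  rw [this, inner_smul_right, b.orthonormal.2 hij, mul_zero]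

end Abstract

theorem integrable_mul_of_hasSum {X ι : Type*} [MeasurableSpace X] {μ : Measure X}
    {f : ι → X → ℝ} {ρ w : X → ℝ} (hf0 : ∀ j x, 0 ≤ f j x)
    (hf : ∀ j, AEStronglyMeasurable (f j) μ) (hs : ∀ᵐ x ∂μ, HasSum (fun j => f j x) (ρ x))
    (hw : AEStronglyMeasurable w μ) (hi : Integrable (fun x => w x * ρ x) μ) (j : ι) :
    Integrable (fun x => w x * f j x) μ := by
  refine hi.mono (hw.mul (hf j)) ?_
  filter_upwards [hs] with x hx
  rw [norm_mul, norm_mul]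
  refine mul_le_mul_of_nonneg_left ?_ (norm_nonneg _)
  rw [Real.norm_of_nonneg (hf0 j x), Real.norm_of_nonneg (hx.nonneg fun j => hf0 j x)]
  exact le_hasSum hx j fun k _ => hf0 k x

/-- The weight w may change sign; domination comes from Σ |w| f_j = |w| ρ. It is used with the
weights 1, the Coulomb potential and ρ^(p-1). -/
theorem hasSum_integral_mul_of_hasSum {X ι : Type*} [MeasurableSpace X] {μ : Measure X}
    [Countable ι] {f : ι → X → ℝ} {ρ w : X → ℝ} (hf0 : ∀ j x, 0 ≤ f j x)
    (hf : ∀ j, AEStronglyMeasurable (f j) μ) (hs : ∀ᵐ x ∂μ, HasSum (fun j => f j x) (ρ x))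
    (hw : AEStronglyMeasurable w μ) (hi : Integrable (fun x => w x * ρ x) μ) :
    HasSum (fun j => ∫ x, w x * f j x ∂μ) (∫ x, w x * ρ x ∂μ) := by
  refine hasSum_integral_of_dominated_convergence (fun j x => ‖w x‖ * f j x)
    (fun j => hw.mul (hf j)) (fun j => Filter.Eventually.of_forall fun x => ?_) ?_ ?_ ?_
  · rw [norm_mul, Real.norm_of_nonneg (hf0 j x)]
  · filter_upwards [hs] with x hx using hx.summable.mul_left _
  · refine hi.norm.congr ?_
    filter_upwards [hs] with x hx
    rw [(hx.mul_left ‖w x‖).tsum_eq, norm_mul, Real.norm_of_nonneg (hx.nonneg fun j => hf0 j x)]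
  · filter_upwards [hs] with x hx using hx.mul_left _

/-! ### Partial inner products of square integrable kernels -/

section Kernel

variable {X Z : Type*} [MeasurableSpace X] [MeasurableSpace Z] {μ : Measure X} {ν : Measure Z}

theorem eLpNorm_two_eq {G : Type*} [NormedAddCommGroup G] (f : X → G) :
    eLpNorm f 2 μ = (∫⁻ x, ‖f x‖ₑ ^ (2:ℝ) ∂μ) ^ (1 / (2:ℝ)) := by
  rw [eLpNorm_eq_lintegral_rpow_enorm_toReal (by norm_num) (by norm_num)]; norm_num

theorem memLp_two_mul {a b : X → ℝ} (ha : MemLp a 2 μ) (hb : MemLp b 2 μ) :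
    Integrable (fun x => a x * b x) μ := ha.integrable_mul hb

theorem integrable_of_norm_le_mul {E F G : Type*} [NormedAddCommGroup E] [NormedAddCommGroup F]
    [NormedAddCommGroup G] {a : X → E} {b : X → F} {k : X → G} (ha : MemLp a 2 μ)
    (hb : MemLp b 2 μ) (hk : AEStronglyMeasurable k μ) (h : ∀ x, ‖k x‖ ≤ ‖a x‖ * ‖b x‖) :
    Integrable k μ :=
  (memLp_two_mul ha.norm hb.norm).mono' hk (Filter.Eventually.of_forall h)

theorem integrable_real_inner {a b : X → ℂ} (ha : MemLp a 2 μ) (hb : MemLp b 2 μ) :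
    Integrable (fun x => inner ℝ (a x) (b x)) μ :=
  integrable_of_norm_le_mul ha hb (ha.1.inner hb.1) fun _ => norm_inner_le_norm _ _

theorem memLp_prod_smul [SFinite μ] [SFinite ν] {φ : X → ℝ} {b : Z → ℂ} (hφ : MemLp φ 2 μ)
    (hb : MemLp b 2 ν) : MemLp (fun z : X × Z => φ z.1 • b z.2) 2 (μ.prod ν) := by
  have hm : AEStronglyMeasurable (fun z : X × Z => φ z.1 • b z.2) (μ.prod ν) :=
    hφ.1.comp_fst.smul hb.1.comp_snd
  rw [memLp_two_iff_integrable_sq_norm hm]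
  have := ((memLp_two_iff_integrable_sq_norm hφ.1).1 hφ).mul_prod
    ((memLp_two_iff_integrable_sq_norm hb.1).1 hb)
  simpa [norm_smul, mul_pow] using this

theorem ae_memLp_slice [SFinite μ] [SFinite ν] {F : X × Z → ℂ} (hF : MemLp F 2 (μ.prod ν)) :
    ∀ᵐ x ∂μ, MemLp (fun z => F (x, z)) 2 ν := by
  filter_upwards [((memLp_two_iff_integrable_sq_norm hF.1).1 hF).prod_right_ae,
    hF.1.prodMk_left] with x hx hm
  exact (memLp_two_iff_integrable_sq_norm hm).2 hx

/-- Cauchy–Schwarz in z, then Tonelli. The free integrand `k` covers both the scalar pairing and the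
vector-valued integral ∫ φ F. -/
theorem eLpNorm_two_integral_le [SFinite μ] [SFinite ν] {E : Type*} [NormedAddCommGroup E]
    [NormedSpace ℝ E] {F : X × Z → ℂ} {b : Z → ℂ} {k : X × Z → E} (hF : MemLp F 2 (μ.prod ν))
    (hb : MemLp b 2 ν) (h : ∀ x z, ‖k (x, z)‖ ≤ ‖F (x, z)‖ * ‖b z‖) :
    eLpNorm (fun x => ∫ z, k (x, z) ∂ν) 2 μ ≤ eLpNorm F 2 (μ.prod ν) * eLpNorm b 2 ν := by
  have key : ∀ᵐ x ∂μ, ‖∫ z, k (x, z) ∂ν‖ₑ ^ (2:ℝ)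
      ≤ (∫⁻ z, ‖F (x, z)‖ₑ ^ (2:ℝ) ∂ν) * (∫⁻ z, ‖b z‖ₑ ^ (2:ℝ) ∂ν) := by
    filter_upwards [hF.1.prodMk_left] with x hx
    have h1 : ‖∫ z, k (x, z) ∂ν‖ₑ ≤ ∫⁻ z, ‖F (x, z)‖ₑ * ‖b z‖ₑ ∂ν := by
      refine (enorm_integral_le_lintegral_enorm _).trans (lintegral_mono fun z => ?_)
      rw [← enorm_norm (F (x, z)), ← enorm_norm (b z), ← enorm_mul, ← enorm_norm (k (x, z))]
      refine enorm_le_iff_norm_le.2 ?_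
      simpa using h x z
    have h2 := ENNReal.lintegral_mul_le_Lp_mul_Lq ν (p := 2) (q := 2)
      (Real.HolderConjugate.two_two) hx.enorm hb.1.enorm
    refine (ENNReal.rpow_le_rpow (h1.trans h2) (by norm_num)).trans (le_of_eq ?_)
    rw [ENNReal.mul_rpow_of_nonneg _ _ (by norm_num), ← ENNReal.rpow_mul, ← ENNReal.rpow_mul]
    norm_num
  rw [eLpNorm_two_eq, eLpNorm_two_eq, eLpNorm_two_eq, ← ENNReal.mul_rpow_of_nonneg _ _ (by norm_num)]
  refine ENNReal.rpow_le_rpow ?_ (by norm_num)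
  refine (lintegral_mono_ae key).trans ?_
  have hfin : ∫⁻ z, ‖b z‖ₑ ^ (2:ℝ) ∂ν ≠ ⊤ := by
    have := hb.2
    rw [eLpNorm_two_eq] at this
    exact (ENNReal.rpow_lt_top_iff_of_pos (by norm_num)).1 this |>.ne
  rw [lintegral_mul_const' _ _ hfin, lintegral_prod _ (hF.1.enorm.pow_const 2)]

/-- The partial inner product of `F` with `b` in the second variable. -/
def contr (ν : Measure Z) (F : X × Z → ℂ) (b : Z → ℂ) (x : X) : ℝ :=
  ∫ z, inner ℝ (F (x, z)) (b z) ∂ν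

theorem eLpNorm_contr_le [SFinite μ] [SFinite ν] {F : X × Z → ℂ} {b : Z → ℂ}
    (hF : MemLp F 2 (μ.prod ν)) (hb : MemLp b 2 ν) :
    eLpNorm (contr ν F b) 2 μ ≤ eLpNorm F 2 (μ.prod ν) * eLpNorm b 2 ν :=
  eLpNorm_two_integral_le hF hb (k := fun w => inner ℝ (F w) (b w.2))
    fun x z => norm_inner_le_norm (F (x, z)) (b z)

theorem memLp_contr [SFinite μ] [SFinite ν] {F : X × Z → ℂ} {b : Z → ℂ}
    (hF : MemLp F 2 (μ.prod ν)) (hb : MemLp b 2 ν) : MemLp (contr ν F b) 2 μ :=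
  ⟨(hF.1.inner hb.1.comp_snd :
      AEStronglyMeasurable (fun w => inner ℝ (F w) (b w.2)) (μ.prod ν)).integral_prod_right', (eLpNorm_contr_le hF hb).trans_lt
    (ENNReal.mul_lt_top hF.2 hb.2)⟩

theorem contr_eq_inner {X : Type*} {F : X × Z → ℂ} {x : X} (h : MemLp (fun z => F (x, z)) 2 ν)
    (b : Lp ℂ 2 ν) : contr ν F b x = inner ℝ (h.toLp _) b := by
  rw [L2.inner_def]
  refine integral_congr_ae ?_
  filter_upwards [h.coeFn_toLp] with z hz
  rw [hz]

/-- Integration against a square integrable kernel, as a bounded operator. -/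
def contrOp [SFinite μ] [SFinite ν] {F : X × Z → ℂ} (hF : MemLp F 2 (μ.prod ν)) :
    Lp ℂ 2 ν →L[ℝ] Lp ℝ 2 μ :=
  LinearMap.mkContinuous
    { toFun := fun b => (memLp_contr hF (Lp.memLp b)).toLp _
      map_add' := fun b b' => by
        rw [← MemLp.toLp_add]
        refine MemLp.toLp_congr _ _ ?_
        filter_upwards [ae_memLp_slice hF] with x hx
        simp only [Pi.add_apply, contr_eq_inner hx, inner_add_right]
      map_smul' := fun c b => by
        rw [RingHom.id_apply, ← MemLp.toLp_const_smul]
        refine MemLp.toLp_congr _ _ ?_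
        filter_upwards [ae_memLp_slice hF] with x hx
        simp only [Pi.smul_apply, contr_eq_inner hx, inner_smul_right, smul_eq_mul] }
    (eLpNorm F 2 (μ.prod ν)).toReal
    fun b => by
      simp only [LinearMap.coe_mk, AddHom.coe_mk]
      rw [Lp.norm_toLp, Lp.norm_def, ← ENNReal.toReal_mul]
      exact ENNReal.toReal_mono (ENNReal.mul_ne_top hF.2.ne (Lp.eLpNorm_ne_top b))
        (eLpNorm_contr_le hF (Lp.memLp b))

theorem coeFn_contrOp [SFinite μ] [SFinite ν] {F : X × Z → ℂ} (hF : MemLp F 2 (μ.prod ν))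
    (b : Lp ℂ 2 ν) : contrOp hF b =ᵐ[μ] contr ν F b := by
  simp only [contrOp, LinearMap.mkContinuous_apply, LinearMap.coe_mk, AddHom.coe_mk]
  exact MemLp.coeFn_toLp _

theorem inner_contrOp [SFinite μ] [SFinite ν] {F : X × Z → ℂ} (hF : MemLp F 2 (μ.prod ν))
    (b b' : Lp ℂ 2 ν) : inner ℝ (contrOp hF b) (contrOp hF b')
      = ∫ x, contr ν F b x * contr ν F b' x ∂μ := by
  rw [L2.inner_def]
  refine integral_congr_ae ?_
  filter_upwards [coeFn_contrOp hF b, coeFn_contrOp hF b'] with x h1 h2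
  rw [h1, h2, real_inner_eq_re_inner]
  simp [mul_comm]

/-- Parseval for each slice F(x, ·). The basis is one over ℝ, so real parts of inner products alone
recover the full norm. -/
theorem hasSum_contr_sq [SFinite μ] [SFinite ν] {F : X × Z → ℂ} (hF : MemLp F 2 (μ.prod ν))
    {ι : Type*} (b : HilbertBasis ι ℝ (Lp ℂ 2 ν)) :
    ∀ᵐ x ∂μ, HasSum (fun j => contr ν F (b j) x ^ 2) (∫ z, ‖F (x, z)‖ ^ 2 ∂ν) := by
  filter_upwards [ae_memLp_slice hF] with x hx
  have h := b.hasSum_inner_mul_inner (hx.toLp _) (hx.toLp _)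
  have e : ∫ z, ‖F (x, z)‖ ^ 2 ∂ν = inner ℝ (hx.toLp _) (hx.toLp _) := by
    rw [L2.inner_def]
    refine integral_congr_ae ?_
    filter_upwards [hx.coeFn_toLp] with z hz
    rw [hz, real_inner_self_eq_norm_sq]
  rw [e]
  refine h.congr_fun fun j => ?_
  rw [contr_eq_inner hx, real_inner_comm (hx.toLp _) (b j), sq]

theorem hasSum_integral_contr_sq [SFinite μ] [SFinite ν] {F : X × Z → ℂ}
    (hF : MemLp F 2 (μ.prod ν)) {ι : Type*} [Countable ι] (b : HilbertBasis ι ℝ (Lp ℂ 2 ν)) :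
    HasSum (fun j => ∫ x, contr ν F (b j) x ^ 2 ∂μ) (∫ x, ∫ z, ‖F (x, z)‖ ^ 2 ∂ν ∂μ) := by
  have := hasSum_integral_mul_of_hasSum (w := fun _ => 1) (fun j x => sq_nonneg (contr ν F (b j) x))
    (fun j => (memLp_contr hF (Lp.memLp (b j))).1.pow 2) (hasSum_contr_sq hF b)
    aestronglyMeasurable_const (by
      simpa using ((memLp_two_iff_integrable_sq_norm hF.1).1 hF).integral_prod_left)
  simpa using this

/-- Schmidt decomposition of a square integrable kernel. -/
theorem exists_hilbertBasis_contr_orthogonal.{u} {X : Type*} {Z : Type u} [MeasurableSpace X]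
    [MeasurableSpace Z] {μ : Measure X} {ν : Measure Z} [SFinite μ] [SFinite ν]
    [TopologicalSpace.SeparableSpace (Lp ℂ 2 ν)] {F : X × Z → ℂ} (hF : MemLp F 2 (μ.prod ν)) :
    ∃ (ι : Type u) (_ : Countable ι) (b : HilbertBasis ι ℝ (Lp ℂ 2 ν)), ∀ i j, i ≠ j →
      ∫ x, contr ν F (b i) x * contr ν F (b j) x ∂μ = 0 := by
  -- An arbitrary basis b₀ serves to show that T is Hilbert–Schmidt, hence compact; the basis
  -- returned at the end is the one adapted to T.
  obtain ⟨w, b₀, -⟩ := exists_hilbertBasis ℝ (Lp ℂ 2 ν)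
  have := Orthonormal.countable_index b₀.orthonormal
  have hc : IsCompactOperator (contrOp hF) := by
    refine isCompactOperator_of_summable_norm_sq b₀ _ ?_
    refine (hasSum_integral_contr_sq hF b₀).summable.congr fun j => ?_
    rw [← real_inner_self_eq_norm_sq, inner_contrOp]
    simp [sq]
  obtain ⟨ι, b, hb⟩ := exists_hilbertBasis_orthogonal_image hc
  exact ⟨ι, Orthonormal.countable_index b.orthonormal, b, fun i j hij => by
    rw [← inner_contrOp hF]; exact hb i j hij⟩

theorem memLp_integral_smul [SFinite μ] [SFinite ν] {F : X × Z → ℂ} {φ : X → ℝ}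
    (hF : MemLp F 2 (μ.prod ν)) (hφ : MemLp φ 2 μ) :
    MemLp (fun z => ∫ x, φ x • F (x, z) ∂μ) 2 ν := by
  have hFs : MemLp (fun w : Z × X => F w.swap) 2 (ν.prod μ) :=
    hF.comp_measurePreserving Measure.measurePreserving_swap
  refine ⟨?_, (eLpNorm_two_integral_le hFs hφ.ofReal (k := fun w : Z × X => φ w.2 • F w.swap)
    fun z x => ?_).trans_lt (ENNReal.mul_lt_top hFs.2 hφ.ofReal.2)⟩
  · exact ((hφ.1.comp_snd (μ := ν)).smul hFs.1).integral_prod_right'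
  · simp [mul_comm]

theorem integrable_inner_smul_prod [SFinite μ] [SFinite ν] {F : X × Z → ℂ} {φ : X → ℝ} {b : Z → ℂ}
    (hF : MemLp F 2 (μ.prod ν)) (hφ : MemLp φ 2 μ) (hb : MemLp b 2 ν) :
    Integrable (fun w : X × Z => φ w.1 * inner ℝ (F w) (b w.2)) (μ.prod ν) := by
  refine (integrable_real_inner hF (memLp_prod_smul hφ hb)).congr
    (Filter.Eventually.of_forall fun w => ?_)
  simp only [inner_smul_right]

/-- Fubini for the pairing of a kernel with functions of both variables. -/
theorem integral_mul_contr [SFinite μ] [SFinite ν] {F : X × Z → ℂ} {φ : X → ℝ} {b : Z → ℂ}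
    (hF : MemLp F 2 (μ.prod ν)) (hφ : MemLp φ 2 μ) (hb : MemLp b 2 ν) :
    ∫ x, φ x * contr ν F b x ∂μ = ∫ z, inner ℝ (∫ x, φ x • F (x, z) ∂μ) (b z) ∂ν := by
  have hi := integrable_inner_smul_prod hF hφ hb
  have h1 : ∫ x, φ x * contr ν F b x ∂μ
      = ∫ x, ∫ z, φ x * inner ℝ (F (x, z)) (b z) ∂ν ∂μ := by
    simp only [contr, integral_const_mul]
  rw [h1, integral_integral_swap hi]
  have hFs : MemLp (fun w : Z × X => F w.swap) 2 (ν.prod μ) :=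
    hF.comp_measurePreserving Measure.measurePreserving_swap
  refine integral_congr_ae ?_
  filter_upwards [ae_memLp_slice hFs] with z hz
  have hint : Integrable (fun x => φ x • F (x, z)) μ :=
    integrable_of_norm_le_mul hφ hz (hφ.1.smul hz.1) fun x => (norm_smul _ _).le
  rw [real_inner_comm, ← integral_inner hint]
  refine integral_congr_ae (Filter.Eventually.of_forall fun x => ?_)
  simp only [inner_smul_right, real_inner_comm]

end Kernel

/-! ### Splitting off one particle -/

section Split

variable {N : ℕ}

@[simp] theorem insertAt_self (i : Fin N) (x : E3) (z : {j : Fin N // j ≠ i} → E3) :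
    insertAt i x z i = x := by simp [insertAt]

theorem insertAt_of_ne {i j : Fin N} (h : j ≠ i) (x : E3) (z : {j : Fin N // j ≠ i} → E3) :
    insertAt i x z j = z ⟨j, h⟩ := by simp [insertAt, h]

@[simp] theorem insertAt_coe {i : Fin N} (x : E3) (z : {j : Fin N // j ≠ i} → E3)
    (j : {j : Fin N // j ≠ i}) : insertAt i x z j = z j := insertAt_of_ne j.2 x z

theorem insertAt_restrict (i : Fin N) (X : Conf N) :
    insertAt i (X i) (fun j : {j : Fin N // j ≠ i} => X j) = X := by
  ext1 j
  by_cases h : j = i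
  · subst h; simp
  · rw [insertAt_of_ne h]

theorem update_insertAt (i : Fin N) (x t : E3) (z : {j : Fin N // j ≠ i} → E3) :
    Function.update (insertAt i x z) i t = insertAt i t z := by
  ext1 j
  by_cases h : j = i
  · subst h; simp
  · rw [Function.update_of_ne h, insertAt_of_ne h, insertAt_of_ne h]

theorem continuous_insertAt (i : Fin N) :
    Continuous fun w : E3 × ({j : Fin N // j ≠ i} → E3) => insertAt i w.1 w.2 := by
  refine continuous_pi fun j => ?_
  by_cases h : j = i
  · subst h; simpa using continuous_fst
  · simp only [insertAt_of_ne h]; fun_prop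

/-- The splitting of a configuration into the position of particle `i` and the others. -/
def splitAt (i : Fin N) : Conf N ≃ᵐ E3 × ({j : Fin N // j ≠ i} → E3) where
  toFun X := (X i, fun j => X j)
  invFun w := insertAt i w.1 w.2
  left_inv X := insertAt_restrict i X
  right_inv w := by ext1 <;> simp
  measurable_toFun := by
    change Measurable fun X : Conf N => (X i, fun j : {j : Fin N // j ≠ i} => X j)
    fun_prop
  measurable_invFun := (continuous_insertAt i).measurable

@[simp] theorem splitAt_symm_apply (i : Fin N) (w : E3 × ({j : Fin N // j ≠ i} → E3)) :
    (splitAt i).symm w = insertAt i w.1 w.2 := rfl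

@[simp] theorem splitAt_apply (i : Fin N) (X : Conf N) :
    splitAt i X = (X i, fun j : {j : Fin N // j ≠ i} => X j) := rfl

theorem measurePreserving_pi_split {ι β : Type*} [Fintype ι] [DecidableEq ι] [MeasurableSpace β]
    (i : ι) (μ : Measure β) [SigmaFinite μ] :
    MeasurePreserving (fun X : ι → β => (X i, fun j : {j : ι // j ≠ i} => X j))
      (Measure.pi fun _ => μ) (μ.prod (Measure.pi fun _ => μ)) := by
  have h1 := measurePreserving_piEquivPiSubtypeProd (fun _ : ι => μ) (fun j => j = i)
  have h2 : ∀ fi : Fintype {j : ι // j = i}, MeasurePreserving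
      (MeasurableEquiv.funUnique {j : ι // j = i} β) (Measure.pi fun _ => μ) μ := fun fi => by
    rw [Subsingleton.elim fi Unique.fintype]
    exact measurePreserving_funUnique μ _
  exact ((h2 _).prod (MeasurePreserving.id _)).comp h1

theorem measurePreserving_splitAt (i : Fin N) :
    MeasurePreserving (splitAt i) (volume : Measure (Conf N)) (volume.prod volume) := by
  exact measurePreserving_pi_split i (volume : Measure E3)

theorem measurePreserving_insertAt (i : Fin N) :
    MeasurePreserving (fun w : E3 × ({j : Fin N // j ≠ i} → E3) => insertAt i w.1 w.2)
      (volume.prod volume) (volume : Measure (Conf N)) :=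
  (measurePreserving_splitAt i).symm

theorem measurableEmbedding_insertAt (i : Fin N) :
    MeasurableEmbedding fun w : E3 × ({j : Fin N // j ≠ i} → E3) => insertAt i w.1 w.2 :=
  (splitAt i).symm.measurableEmbedding

theorem integral_conf {E : Type*} [NormedAddCommGroup E] [NormedSpace ℝ E] (i : Fin N)
    (f : Conf N → E) : ∫ X, f X = ∫ w : E3 × ({j : Fin N // j ≠ i} → E3),
      f (insertAt i w.1 w.2) ∂(volume.prod volume) :=
  ((measurePreserving_insertAt i).integral_comp (measurableEmbedding_insertAt i) f).symm

theorem integral_conf_iterated {E : Type*} [NormedAddCommGroup E] [NormedSpace ℝ E] (i : Fin N)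
    {f : Conf N → E} (hf : Integrable f) : ∫ X, f X = ∫ x, ∫ z, f (insertAt i x z) := by
  rw [integral_conf i, integral_prod]
  exact (measurePreserving_insertAt i).integrable_comp_of_integrable hf

theorem memLp_insertAt {E : Type*} [NormedAddCommGroup E] (i : Fin N) {f : Conf N → E}
    {q : ENNReal} (hf : MemLp f q volume) :
    MemLp (fun w : E3 × ({j : Fin N // j ≠ i} → E3) => f (insertAt i w.1 w.2)) q
      (volume.prod volume) :=
  hf.comp_measurePreserving (measurePreserving_insertAt i)

theorem memLp_of_insertAt {E : Type*} [NormedAddCommGroup E] (i : Fin N) {f : Conf N → E}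
    {q : ENNReal} (hf : MemLp (fun w : E3 × ({j : Fin N // j ≠ i} → E3) =>
      f (insertAt i w.1 w.2)) q (volume.prod volume)) : MemLp f q volume := by
  have := hf.comp_measurePreserving (measurePreserving_splitAt i)
  simpa only [Function.comp_def, splitAt_apply, insertAt_restrict] using this

/-- Exchanging particle `i` with an auxiliary particle preserves the measure. -/
theorem measurePreserving_exchange (i : Fin N) :
    MeasurePreserving (fun w : Conf N × E3 => (Function.update w.1 i w.2, w.1 i))
      (volume.prod volume) (volume.prod volume) := by
  let Z := {j : Fin N // j ≠ i} → E3
  -- After splitting off particle i, the exchange is a swap of the two E3 factors.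
  have hE : MeasurePreserving (fun w : (E3 × Z) × E3 => ((w.2, w.1.2), w.1.1))
      (((volume : Measure E3).prod (volume : Measure Z)).prod volume)
      ((volume.prod volume).prod volume) := by
    have a1 : MeasurePreserving (Prod.swap : (E3 × Z) × E3 → E3 × (E3 × Z))
      (((volume : Measure E3).prod (volume : Measure Z)).prod volume)
      (volume.prod (volume.prod volume)) := Measure.measurePreserving_swap
    have a2 := (measurePreserving_prodAssoc (volume : Measure E3) (volume : Measure E3)
      (volume : Measure Z))
    have a3 := (Measure.measurePreserving_swap (μ := (volume : Measure E3))
      (ν := (volume : Measure E3))).prod (MeasurePreserving.id (volume : Measure Z))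
    have a4 : MeasurePreserving (Prod.swap : E3 × (E3 × Z) → (E3 × Z) × E3)
      (volume.prod (volume.prod volume))
      (((volume : Measure E3).prod (volume : Measure Z)).prod volume) :=
        Measure.measurePreserving_swap
    exact a4.comp (a2.comp (a3.comp ((MeasurePreserving.symm _ a2).comp a1)))
  have h1 := (measurePreserving_splitAt i).prod (MeasurePreserving.id (volume : Measure E3))
  have h2 := (measurePreserving_insertAt i).prod (MeasurePreserving.id (volume : Measure E3))
  have h := h2.comp (hE.comp h1)
  convert h using 1
  ext1 w
  simp only [Function.comp_apply, Prod.map, splitAt_apply, id]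
  rw [← update_insertAt i (w.1 i) w.2, insertAt_restrict]

theorem measurableEmbedding_exchange (i : Fin N) :
    MeasurableEmbedding (fun w : Conf N × E3 => (Function.update w.1 i w.2, w.1 i)) := by
  have hm := (measurePreserving_exchange (N := N) i).measurable
  let e : Conf N × E3 ≃ᵐ Conf N × E3 :=
    { toFun := fun w => (Function.update w.1 i w.2, w.1 i)
      invFun := fun w => (Function.update w.1 i w.2, w.1 i)
      left_inv := fun w => by simp
      right_inv := fun w => by simp
      measurable_toFun := hm
      measurable_invFun := hm }
  exact e.measurableEmbedding

theorem measurePreserving_perm (σ : Equiv.Perm (Fin N)) :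
    MeasurePreserving (fun (X : Conf N) (j : Fin N) => X (σ j)) volume volume := by
  have := volume_measurePreserving_piCongrLeft (fun _ : Fin N => E3) σ.symm
  convert this using 1
  ext1 X
  ext1 j
  have := MeasurableEquiv.piCongrLeft_apply_apply (β := fun _ : Fin N => E3) σ.symm X (σ j)
  rw [Equiv.symm_apply_apply] at this
  exact this.symm

theorem measurableEmbedding_perm (σ : Equiv.Perm (Fin N)) :
    MeasurableEmbedding (fun (X : Conf N) (j : Fin N) => X (σ j)) := by
  let e : Conf N ≃ᵐ Conf N :=
    { toFun := fun X j => X (σ j)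
      invFun := fun X j => X (σ.symm j)
      left_inv := fun X => by simp
      right_inv := fun X => by simp
      measurable_toFun := (measurePreserving_perm σ).measurable
      measurable_invFun := (measurePreserving_perm σ.symm).measurable }
  exact e.measurableEmbedding

theorem integral_perm {E : Type*} [NormedAddCommGroup E] [NormedSpace ℝ E]
    (σ : Equiv.Perm (Fin N)) (f : Conf N → E) : ∫ X : Conf N, f (fun j => X (σ j)) = ∫ X, f X :=
  (measurePreserving_perm σ).integral_comp (measurableEmbedding_perm σ) f

end Split

/-! ### Weak derivatives: elementary properties -/

section Weak

variable {X F : Type*} [NormedAddCommGroup X] [NormedSpace ℝ X] [MeasureSpace X]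
  [NormedAddCommGroup F] [NormedSpace ℝ F]

theorem HasWeakDeriv.congr {f f' g g' : X → F} {v : X} (h : HasWeakDeriv f g v)
    (hf : f =ᵐ[volume] f') (hg : g =ᵐ[volume] g') : HasWeakDeriv f' g' v := by
  intro φ hφ hc
  have h1 : ∫ x, (fderiv ℝ φ x v) • f' x = ∫ x, (fderiv ℝ φ x v) • f x :=
    integral_congr_ae (by filter_upwards [hf] with x hx; rw [hx])
  have h2 : ∫ x, φ x • g' x = ∫ x, φ x • g x :=
    integral_congr_ae (by filter_upwards [hg] with x hx; rw [hx])
  rw [h1, h2]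
  exact h φ hφ hc

/-- The equality is literal, not only a.e.: functions that agree a.e. have the same set of weak
derivatives, so the choice returns the same representative. -/
theorem weakDeriv_congr {f f' : X → F} (hf : f =ᵐ[volume] f') (v : X) :
    weakDeriv f v = weakDeriv f' v := by
  have : (fun g : X → F => MemLp g 2 volume ∧ HasWeakDeriv f g v)
      = fun g => MemLp g 2 volume ∧ HasWeakDeriv f' g v := by
    ext g
    exact ⟨fun h => ⟨h.1, h.2.congr hf (.refl _ _)⟩, fun h => ⟨h.1, h.2.congr hf.symm (.refl _ _)⟩⟩
  classical
  have key : ∀ P P' : (X → F) → Prop, P = P' → (if h : ∃ g, P g then h.choose else 0)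
      = if h : ∃ g, P' g then h.choose else 0 := by
    rintro P _ rfl
    rfl
  unfold weakDeriv
  convert key _ _ this

theorem MemH1.congr {f f' : X → F} (h : MemH1 f) (hf : f =ᵐ[volume] f') : MemH1 f' :=
  ⟨h.1.ae_eq hf, fun v => by
    obtain ⟨g, hg, hw⟩ := h.2 v
    exact ⟨g, hg, hw.congr hf (.refl _ _)⟩⟩

theorem HasWeakDeriv.const_smul {𝕜 : Type*} [RCLike 𝕜] [NormedSpace 𝕜 F] [SMulCommClass ℝ 𝕜 F]
    {f g : X → F} {v : X} (c : 𝕜) (h : HasWeakDeriv f g v) :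
    HasWeakDeriv (fun x => c • f x) (fun x => c • g x) v := by
  intro φ hφ hc
  simp only [smul_comm _ c, integral_smul]
  rw [h φ hφ hc, smul_neg]

/-- Weak derivatives are compatible with measure preserving linear changes of variables. -/
theorem HasWeakDeriv.comp_equiv {f g : X → F} {v : X} (h : HasWeakDeriv f g v) (L : X ≃L[ℝ] X)
    (hL : MeasurePreserving L volume volume) (hLe : MeasurableEmbedding L) :
    HasWeakDeriv (fun x => f (L x)) (fun x => g (L x)) (L.symm v) := by
  intro φ hφ hc
  have h1 := h (fun y => φ (L.symm y)) (hφ.comp L.symm.contDiff)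
    (hc.comp_homeomorph L.symm.toHomeomorph)
  rw [← hL.integral_comp hLe (fun y => fderiv ℝ (fun y => φ (L.symm y)) y v • f y),
    ← hL.integral_comp hLe (fun y => φ (L.symm y) • g y)] at h1
  have h2 : ∀ x, fderiv ℝ (fun y => φ (L.symm y)) (L x) v = fderiv ℝ φ x (L.symm v) := by
    intro x
    have := ((hφ.differentiable (by simp) (L.symm (L x))).hasFDerivAt.comp (L x)
      L.symm.hasFDerivAt).fderiv
    rw [show (fun y => φ (L.symm y)) = φ ∘ L.symm from rfl, this]
    simp
  simpa [h2] using h1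

end Weak

section WeakLinear

variable {X F : Type*} [NormedAddCommGroup X] [NormedSpace ℝ X] [MeasureSpace X]
  [BorelSpace X] [NormedAddCommGroup F] [NormedSpace ℝ F]

theorem integrable_fderiv_smul {φ : X → ℝ} {f : X → F} (hφ : ContDiff ℝ ∞ φ)
    (hc : HasCompactSupport φ) (hf : LocallyIntegrable f) (v : X) :
    Integrable fun x => fderiv ℝ φ x v • f x :=
  hf.integrable_smul_left_of_hasCompactSupport
    ((hφ.continuous_fderiv (by simp)).clm_apply continuous_const) (hc.fderiv_apply ℝ v)

theorem integrable_test_smul {φ : X → ℝ} {f : X → F} (hφ : ContDiff ℝ ∞ φ)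
    (hc : HasCompactSupport φ) (hf : LocallyIntegrable f) : Integrable fun x => φ x • f x :=
  hf.integrable_smul_left_of_hasCompactSupport hφ.continuous hc

theorem HasWeakDeriv.sum {ι : Type*} (s : Finset ι) {f g : ι → X → F} {v : X}
    (hf : ∀ k ∈ s, LocallyIntegrable (f k)) (hg : ∀ k ∈ s, LocallyIntegrable (g k))
    (h : ∀ k ∈ s, HasWeakDeriv (f k) (g k) v) :
    HasWeakDeriv (fun x => ∑ k ∈ s, f k x) (fun x => ∑ k ∈ s, g k x) v := by
  intro φ hφ hc
  simp only [Finset.smul_sum]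
  rw [integral_finsetSum _ fun k hk => integrable_fderiv_smul hφ hc (hf k hk) v,
    integral_finsetSum _ fun k hk => integrable_test_smul hφ hc (hg k hk),
    ← Finset.sum_neg_distrib]
  exact Finset.sum_congr rfl fun k hk => h k hk φ hφ hc

theorem HasWeakDeriv.sum_dir {ι : Type*} (s : Finset ι) {f : X → F} {g : ι → X → F} {v : ι → X}
    (c : ι → ℝ) (hf : LocallyIntegrable f) (hg : ∀ k ∈ s, LocallyIntegrable (g k))
    (h : ∀ k ∈ s, HasWeakDeriv f (g k) (v k)) :
    HasWeakDeriv f (fun x => ∑ k ∈ s, c k • g k x) (∑ k ∈ s, c k • v k) := by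
  intro φ hφ hc
  have e1 : ∀ x, fderiv ℝ φ x (∑ k ∈ s, c k • v k) • f x
      = ∑ k ∈ s, c k • (fderiv ℝ φ x (v k) • f x) := fun x => by
    rw [map_sum, Finset.sum_smul]
    exact Finset.sum_congr rfl fun k _ => by rw [map_smul, smul_assoc]
  have e2 : ∀ x, φ x • ∑ k ∈ s, c k • g k x = ∑ k ∈ s, c k • (φ x • g k x) := fun x => by
    rw [Finset.smul_sum]
    exact Finset.sum_congr rfl fun k _ => by rw [smul_comm]
  simp only [e1, e2]
  have i1 : ∀ k ∈ s, Integrable fun x => c k • (fderiv ℝ φ x (v k) • f x) := fun k _ =>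
    (integrable_fderiv_smul hφ hc hf (v k)).smul (c k)
  have i2 : ∀ k ∈ s, Integrable fun x => c k • (φ x • g k x) := fun k hk =>
    (integrable_test_smul hφ hc (hg k hk)).smul (c k)
  rw [integral_finsetSum _ i1, integral_finsetSum _ i2, ← Finset.sum_neg_distrib]
  refine Finset.sum_congr rfl fun k hk => ?_
  rw [integral_smul, integral_smul, h k hk φ hφ hc, smul_neg]

end WeakLinear

theorem HasWeakDeriv.ofReal {X : Type*} [NormedAddCommGroup X] [NormedSpace ℝ X] [MeasureSpace X]
    {f g : X → ℝ} {v : X} (h : HasWeakDeriv f g v) :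
    HasWeakDeriv (fun x => (f x : ℂ)) (fun x => (g x : ℂ)) v := by
  intro φ hφ hc
  have := congrArg (fun r : ℝ => (r : ℂ)) (h φ hφ hc)
  simp only [smul_eq_mul, ← integral_complex_ofReal, Complex.ofReal_neg] at this
  simpa using this

/-! ### Weak derivatives on configuration space. -/

section ConfWeak

variable {N : ℕ}

theorem integral_conf_iterated_symm {E : Type*} [NormedAddCommGroup E] [NormedSpace ℝ E]
    (i : Fin N) {f : Conf N → E} (hf : Integrable f) :
    ∫ X, f X = ∫ z, ∫ x, f (insertAt i x z) := by
  rw [integral_conf i, integral_prod_symm]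
  exact (measurePreserving_insertAt i).integrable_comp_of_integrable hf

theorem conf_eq_sum (v : Conf N) :
    v = ∑ k : Fin N × Fin 3, (v k.1 k.2 : ℝ) • (confDir k.1 k.2 : Conf N) := by
  rw [Fintype.sum_prod_type]
  ext j b
  simp only [Finset.sum_apply, Pi.smul_apply, confDir, dir]
  rw [Finset.sum_eq_single j]
  · simp [Fin.sum_univ_three]
    fin_cases b <;> simp
  · intro i _ hi
    simp [Pi.single_eq_of_ne hi.symm]
  · simp

/-- `MemH1` asks for every direction; linearity in the direction reduces this to the coordinate
ones. -/
theorem memH1_of_confDir {Ψ : Conf N → ℂ} (h : MemLp Ψ 2 volume)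
    (hd : ∀ i a, ∃ g : Conf N → ℂ, MemLp g 2 volume ∧ HasWeakDeriv Ψ g (confDir i a)) :
    MemH1 Ψ := by
  refine ⟨h, fun v => ?_⟩
  choose g hg hw using hd
  rw [conf_eq_sum v]
  refine ⟨fun X => ∑ k : Fin N × Fin 3, (v k.1 k.2 : ℝ) • g k.1 k.2 X, ?_,
    HasWeakDeriv.sum_dir _ _ (h.locallyIntegrable (by norm_num))
      (fun k _ => (hg k.1 k.2).locallyIntegrable (by norm_num)) fun k _ => hw k.1 k.2⟩
  exact memLp_finsetSum _ fun k _ => (hg k.1 k.2).const_smul (v k.1 k.2 : ℝ)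

/-- The permutation of particles, as a linear map. -/
def permEquiv (σ : Equiv.Perm (Fin N)) : Conf N ≃L[ℝ] Conf N :=
  (LinearEquiv.funCongrLeft ℝ E3 σ).toContinuousLinearEquiv

theorem permEquiv_apply (σ : Equiv.Perm (Fin N)) (X : Conf N) :
    permEquiv σ X = fun j => X (σ j) := rfl

theorem permEquiv_symm_confDir (σ : Equiv.Perm (Fin N)) (i : Fin N) (a : Fin 3) :
    (permEquiv σ).symm (confDir i a) = confDir (σ i) a := by
  rw [ContinuousLinearEquiv.symm_apply_eq, permEquiv_apply]
  ext1 j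
  by_cases h : j = i
  · subst h; simp [confDir]
  · rw [confDir, confDir, Pi.single_eq_of_ne h, Pi.single_eq_of_ne (σ.injective.ne h)]

theorem HasWeakDeriv.comp_perm {Ψ g : Conf N → ℂ} {i : Fin N} {a : Fin 3}
    (h : HasWeakDeriv Ψ g (confDir i a)) (σ : Equiv.Perm (Fin N)) :
    HasWeakDeriv (fun X => Ψ (fun j => X (σ j))) (fun X => g (fun j => X (σ j)))
      (confDir (σ i) a) := by
  have := h.comp_equiv (permEquiv σ) (measurePreserving_perm σ) (measurableEmbedding_perm σ)
  rwa [permEquiv_symm_confDir] at this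

theorem sign_mul_sign (σ : Equiv.Perm (Fin N)) :
    ((Equiv.Perm.sign σ : ℤ) : ℂ) * ((Equiv.Perm.sign σ : ℤ) : ℂ) = 1 := by
  rw [← Int.cast_mul, ← Units.val_mul, Int.units_mul_self]; simp

theorem norm_sign (σ : Equiv.Perm (Fin N)) : ‖((Equiv.Perm.sign σ : ℤ) : ℂ)‖ = 1 := by
  rcases Int.units_eq_one_or (Equiv.Perm.sign σ) with h | h <;> simp [h]

/-- Permuting particles carries the derivative in particle i to that in particle σ i, and
antisymmetry changes only a sign; uniqueness of weak derivatives concludes. Thus all particles have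
equal kinetic energy. -/
theorem integral_norm_sq_weakDeriv_perm {Ψ : Conf N → ℂ} (hΨ : MemH1 Ψ) (σ : Equiv.Perm (Fin N))
    (ha : (fun X => Ψ (fun j => X (σ j))) =ᵐ[volume]
      fun X => ((Equiv.Perm.sign σ : ℤ) : ℂ) * Ψ X) (i : Fin N) (a : Fin 3) :
    ∫ X, ‖weakDeriv Ψ (confDir (σ i) a) X‖ ^ 2 = ∫ X, ‖weakDeriv Ψ (confDir i a) X‖ ^ 2 := by
  have h1 := hΨ.weakDeriv_spec (confDir i a)
  have h2 := hΨ.weakDeriv_spec (confDir (σ i) a)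
  have h3 := (h1.2.comp_perm σ).const_smul ((Equiv.Perm.sign σ : ℤ) : ℂ)
  have hm := (h1.1.comp_measurePreserving (measurePreserving_perm σ)).const_smul
    ((Equiv.Perm.sign σ : ℤ) : ℂ)
  have h4 : HasWeakDeriv Ψ (fun X => ((Equiv.Perm.sign σ : ℤ) : ℂ) •
      weakDeriv Ψ (confDir i a) (fun j => X (σ j))) (confDir (σ i) a) := by
    refine h3.congr ?_ (.refl _ _)
    filter_upwards [ha] with X hX
    rw [hX, smul_eq_mul, ← mul_assoc, sign_mul_sign, one_mul]
  have h5 := HasWeakDeriv.ae_unique h2.1 hm h2.2 h4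
  calc _ = ∫ X : Conf N, ‖weakDeriv Ψ (confDir i a) (fun j => X (σ j))‖ ^ 2 := by
        refine integral_congr_ae ?_
        filter_upwards [h5] with X hX
        rw [hX]
        simp only [Pi.smul_apply, Function.comp_apply, norm_smul, norm_sign, one_mul]
    _ = _ := integral_perm σ (fun X => ‖weakDeriv Ψ (confDir i a) X‖ ^ 2)

theorem fderiv_comp_insertAt {Φ : Conf N → ℝ} (hΦ : ContDiff ℝ ∞ Φ) (i : Fin N) (a : Fin 3)
    (z : {j : Fin N // j ≠ i} → E3) (x : E3) :
    fderiv ℝ (fun x => Φ (insertAt i x z)) x (dir a) = fderiv ℝ Φ (insertAt i x z) (confDir i a) := by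
  have h1 : HasFDerivAt (fun x => insertAt i x z)
      (ContinuousLinearMap.single ℝ (fun _ : Fin N => E3) i) x := by
    have : (fun x => insertAt i x z) = fun x =>
        ContinuousLinearMap.single ℝ (fun _ : Fin N => E3) i x + insertAt i 0 z := by
      ext1 x; ext1 j
      by_cases h : j = i
      · subst h; simp
      · simp [insertAt_of_ne h, Pi.single_eq_of_ne h]
    rw [this]
    exact (ContinuousLinearMap.hasFDerivAt _).add_const _
  have h2 := ((hΦ.differentiable (by simp) (insertAt i x z)).hasFDerivAt.comp x h1).fderiv
  rw [show (fun x => Φ (insertAt i x z)) = Φ ∘ (fun x => insertAt i x z) from rfl, h2]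
  simp [confDir]

theorem contDiff_insertAt (i : Fin N) (z : {j : Fin N // j ≠ i} → E3) :
    ContDiff ℝ ∞ (fun x : E3 => insertAt i x z) := by
  refine contDiff_pi.2 fun j => ?_
  by_cases h : j = i
  · subst h; simpa using! contDiff_id
  · simp only [insertAt_of_ne h]; exact contDiff_const

theorem hasCompactSupport_comp_insertAt {Φ : Conf N → ℝ} (hc : HasCompactSupport Φ) (i : Fin N)
    (z : {j : Fin N // j ≠ i} → E3) : HasCompactSupport (fun x => Φ (insertAt i x z)) := by
  refine HasCompactSupport.intro (K := (fun X : Conf N => X i) '' tsupport Φ)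
    (IsCompact.image hc (continuous_apply i)) fun x hx => ?_
  by_contra h
  exact hx ⟨insertAt i x z, subset_tsupport _ h, insertAt_self i x z⟩

theorem memLp_prod_mul {X Z : Type*} [MeasurableSpace X] [MeasurableSpace Z] {μ : Measure X}
    {ν : Measure Z} [SFinite μ] [SFinite ν] {u : X → ℂ} {c : Z → ℂ} (hu : MemLp u 2 μ)
    (hc : MemLp c 2 ν) : MemLp (fun w : X × Z => u w.1 * c w.2) 2 (μ.prod ν) := by
  have hm : AEStronglyMeasurable (fun w : X × Z => u w.1 * c w.2) (μ.prod ν) :=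
    hu.1.comp_fst.mul hc.1.comp_snd
  rw [memLp_two_iff_integrable_sq_norm hm]
  have := ((memLp_two_iff_integrable_sq_norm hu.1).1 hu).mul_prod
    ((memLp_two_iff_integrable_sq_norm hc.1).1 hc)
  simpa [mul_pow] using this

theorem memLp_mul_restrict (i : Fin N) {u : E3 → ℂ} {c : ({j : Fin N // j ≠ i} → E3) → ℂ}
    (hu : MemLp u 2 volume) (hc : MemLp c 2 volume) :
    MemLp (fun X : Conf N => u (X i) * c (fun j => X j)) 2 volume :=
  memLp_of_insertAt i (by simpa using memLp_prod_mul hu hc)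

/-- The weak derivative of a product of a function of particle `i` and a function of the others. -/
theorem HasWeakDeriv.mul_restrict {u g : E3 → ℂ} {a : Fin 3} (h : HasWeakDeriv u g (dir a))
    (hu : MemLp u 2 volume) (hg : MemLp g 2 volume) (i : Fin N)
    {c : ({j : Fin N // j ≠ i} → E3) → ℂ} (hc : MemLp c 2 volume) :
    HasWeakDeriv (fun X : Conf N => u (X i) * c (fun j => X j))
      (fun X => g (X i) * c (fun j => X j)) (confDir i a) := by
  intro Φ hΦ hcs
  have i1 :=
    (integrable_fderiv_smul hΦ hcs
      ((memLp_mul_restrict i hu hc).locallyIntegrable (by norm_num)) (confDir i a))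
  have i2 :=
    (integrable_test_smul hΦ hcs ((memLp_mul_restrict i hg hc).locallyIntegrable (by norm_num)))
  rw [integral_conf_iterated_symm i i1, integral_conf_iterated_symm i i2,
    ← integral_neg]
  refine integral_congr_ae (Filter.Eventually.of_forall fun z => ?_)
  have := h (fun x => Φ (insertAt i x z)) (hΦ.comp (contDiff_insertAt i z))
    (hasCompactSupport_comp_insertAt hcs i z)
  simp only [fderiv_comp_insertAt hΦ] at this
  simp only [insertAt_self, insertAt_coe, ← smul_mul_assoc, integral_mul_const]
  rw [this, neg_mul]

/-- Partial inner products of a weakly differentiable function are weakly differentiable. -/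
theorem HasWeakDeriv.contr {Ψ g : Conf N → ℂ} {i : Fin N} {a : Fin 3}
    (h : HasWeakDeriv Ψ g (confDir i a)) (hΨ : MemLp Ψ 2 volume) (hg : MemLp g 2 volume)
    {b : ({j : Fin N // j ≠ i} → E3) → ℂ} (hb : MemLp b 2 volume) :
    HasWeakDeriv (contr volume (fun w => Ψ (insertAt i w.1 w.2)) b)
      (contr volume (fun w => g (insertAt i w.1 w.2)) b) (dir a) := by
  intro φ hφ hc
  have hF := memLp_insertAt i hΨ
  have hG := memLp_insertAt i hg
  have m1 : MemLp (fun x => fderiv ℝ φ x (dir a)) 2 volume :=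
    ((hφ.continuous_fderiv (by simp)).clm_apply continuous_const).memLp_of_hasCompactSupport
      (hc.fderiv_apply ℝ _)
  have m2 : MemLp φ 2 volume := hφ.continuous.memLp_of_hasCompactSupport hc
  simp only [smul_eq_mul]
  rw [integral_mul_contr hF m1 hb, integral_mul_contr hG m2 hb, ← integral_neg]
  have n1 := memLp_integral_smul hF m1
  have n2 := memLp_integral_smul hG m2
  -- Testing with products φ(x_i) χ(others) gives the identity integrated against every χ, hence for
  -- a.e. z.
  have key : ∀ᵐ z : {j : Fin N // j ≠ i} → E3,
      (∫ x, fderiv ℝ φ x (dir a) • Ψ (insertAt i x z)) = - ∫ x, φ x • g (insertAt i x z) := by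
    refine ae_eq_of_integral_contDiff_smul_eq (n1.locallyIntegrable (by norm_num))
      (n2.neg.locallyIntegrable (by norm_num)) fun χ hχ hχc => ?_
    have hΦ : ContDiff ℝ ∞ fun X : Conf N => φ (X i) * χ (fun j => X j) :=
      (hφ.comp (contDiff_apply ℝ E3 i)).mul
        (hχ.comp (contDiff_pi.2 fun j => contDiff_apply ℝ E3 (j : Fin N)))
    have hΦc : HasCompactSupport fun X : Conf N => φ (X i) * χ (fun j => X j) := by
      refine HasCompactSupport.intro
        (K := (fun w : E3 × ({j : Fin N // j ≠ i} → E3) => insertAt i w.1 w.2) ''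
          (tsupport φ ×ˢ tsupport χ))
        ((IsCompact.prod hc hχc).image (continuous_insertAt i)) fun X hX => ?_
      by_contra hne
      refine hX ⟨(X i, fun j => X j), ⟨subset_tsupport _ (left_ne_zero_of_mul hne),
        subset_tsupport _ (right_ne_zero_of_mul hne)⟩, insertAt_restrict i X⟩
    have ht := h _ hΦ hΦc
    have i1 :=
      (integrable_fderiv_smul hΦ hΦc (hΨ.locallyIntegrable (by norm_num)) (confDir i a))
    have i2 :=
      (integrable_test_smul hΦ hΦc (hg.locallyIntegrable (by norm_num)))
    rw [integral_conf_iterated_symm i i1, integral_conf_iterated_symm i i2] at ht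
    simp only [← fderiv_comp_insertAt hΦ, insertAt_self, insertAt_coe] at ht
    have hd : ∀ (x : E3) (z : {j : Fin N // j ≠ i} → E3),
        fderiv ℝ (fun x => φ x * χ z) x (dir a) = χ z * fderiv ℝ φ x (dir a) := fun x z => by
      rw [fderiv_mul_const (hφ.differentiable (by simp) x)]; simp
    simp only [hd, mul_smul, integral_smul] at ht
    rw [ht, ← integral_neg]
    refine integral_congr_ae (Filter.Eventually.of_forall fun z => ?_)
    simp only [smul_neg, ← integral_smul, smul_smul, mul_comm]
  refine integral_congr_ae ?_
  filter_upwards [key] with z hz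
  simp only [hz, inner_neg_left]

end ConfWeak

/-! ### The Pauli principle for one-particle density matrices -/

section Pauli

variable {N : ℕ}

/-- `φ` integrated against the `i`-th variable of `Ψ`. -/
def partialPairing (φ : E3 → ℝ) (Ψ : Conf N → ℂ) (i : Fin N) (X : Conf N) : ℂ :=
  ∫ t, φ t • Ψ (Function.update X i t)

/-- The orthogonal projection of `Ψ` onto multiples of `φ` in the `i`-th variable (for
normalized `φ`). -/
def slotProj (φ : E3 → ℝ) (Ψ : Conf N → ℂ) (i : Fin N) (X : Conf N) : ℂ :=
  φ (X i) • partialPairing φ Ψ i X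

variable {φ : E3 → ℝ} {Ψ : Conf N → ℂ}

theorem partialPairing_insertAt (i : Fin N) (x : E3) (z : {j : Fin N // j ≠ i} → E3) :
    partialPairing φ Ψ i (insertAt i x z) = ∫ t, φ t • Ψ (insertAt i t z) := by
  simp only [partialPairing, update_insertAt]

theorem slotProj_insertAt (i : Fin N) (x : E3) (z : {j : Fin N // j ≠ i} → E3) :
    slotProj φ Ψ i (insertAt i x z) = φ x • ∫ t, φ t • Ψ (insertAt i t z) := by
  rw [slotProj, partialPairing_insertAt, insertAt_self]

theorem memLp_slotProj (hφ : MemLp φ 2 volume) (hΨ : MemLp Ψ 2 volume) (i : Fin N) :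
    MemLp (slotProj φ Ψ i) 2 volume := by
  refine memLp_of_insertAt i ?_
  simp only [slotProj_insertAt]
  exact memLp_prod_smul hφ (memLp_integral_smul (memLp_insertAt i hΨ) hφ)

theorem slotProj_perm
    (ha : ∀ (σ : Equiv.Perm (Fin N)) (X : Conf N),
      Ψ (fun j => X (σ j)) = ((Equiv.Perm.sign σ : ℤ) : ℂ) * Ψ X)
    (σ : Equiv.Perm (Fin N)) (i : Fin N) (X : Conf N) :
    slotProj φ Ψ i (fun j => X (σ j))
      = ((Equiv.Perm.sign σ : ℤ) : ℂ) * slotProj φ Ψ (σ i) X := by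
  have hu : ∀ t, Function.update (fun j => X (σ j)) i t
      = fun j => Function.update X (σ i) t (σ j) := by
    intro t
    ext1 j
    by_cases h : j = i
    · subst h; simp
    · rw [Function.update_of_ne h, Function.update_of_ne (σ.injective.ne h)]
  simp only [slotProj, partialPairing, hu, ha, ← mul_smul_comm, integral_const_mul]

/-- Up to the factor N, the right-hand side is the quadratic form of the one-particle density matrix
at φ. -/
theorem integral_inner_slotProj (hφ : MemLp φ 2 volume) (hΨ : MemLp Ψ 2 volume) (i : Fin N) :
    ∫ X, inner ℝ (Ψ X) (slotProj φ Ψ i X)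
      = ∫ z : {j : Fin N // j ≠ i} → E3, ‖∫ t, φ t • Ψ (insertAt i t z)‖ ^ 2 := by
  have hF := memLp_insertAt i hΨ
  have hc := memLp_integral_smul hF hφ
  rw [integral_conf_iterated i (integrable_real_inner hΨ (memLp_slotProj hφ hΨ i))]
  have h := integral_mul_contr hF hφ hc
  simp only [real_inner_self_eq_norm_sq] at h
  rw [← h]
  refine integral_congr_ae (Filter.Eventually.of_forall fun x => ?_)
  simp only [slotProj_insertAt, inner_smul_right, integral_const_mul, contr]

theorem integral_norm_sq_slotProj (i : Fin N) :
    ∫ X, ‖slotProj φ Ψ i X‖ ^ 2 = (∫ x, φ x ^ 2)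
      * ∫ z : {j : Fin N // j ≠ i} → E3, ‖∫ t, φ t • Ψ (insertAt i t z)‖ ^ 2 := by
  rw [integral_conf i, ← integral_prod_mul]
  simp only [slotProj_insertAt, norm_smul, mul_pow, Real.norm_eq_abs, sq_abs]

/-- An antisymmetric function has no component with φ in two slots. Writing the second projection as
an integral over an auxiliary position t, exchange t with X_i: the factors φ(X_i) and φ(t) trade
places, the pairing in slot i is unchanged, and Ψ changes sign. -/
theorem integral_inner_slotProj_ne
    (ha : ∀ (σ : Equiv.Perm (Fin N)) (X : Conf N),
      Ψ (fun j => X (σ j)) = ((Equiv.Perm.sign σ : ℤ) : ℂ) * Ψ X)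
    (hφ : MemLp φ 2 volume) (hΨ : MemLp Ψ 2 volume) {i j : Fin N} (hij : i ≠ j) :
    ∫ X, inner ℝ (slotProj φ Ψ i X) (slotProj φ Ψ j X) = 0 := by
  let k : Conf N × E3 → ℝ := fun w =>
    inner ℝ (slotProj φ Ψ i w.1) (φ (w.1 j) • φ w.2 • Ψ (Function.update w.1 j w.2))
  have hA : MemLp (fun w : Conf N × E3 => φ w.2 • slotProj φ Ψ i w.1) 2
      ((volume : Measure (Conf N)).prod volume) :=
    (memLp_prod_smul hφ (memLp_slotProj hφ hΨ i)).comp_measurePreserving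
      Measure.measurePreserving_swap
  have hB : MemLp (fun w : Conf N × E3 => φ (w.1 j) • Ψ (Function.update w.1 j w.2)) 2
      ((volume : Measure (Conf N)).prod volume) :=
    ((memLp_prod_smul hφ hΨ).comp_measurePreserving
      Measure.measurePreserving_swap).comp_measurePreserving (measurePreserving_exchange j)
  have hk : Integrable k ((volume : Measure (Conf N)).prod volume) := by
    refine (integrable_real_inner hA hB).congr (Filter.Eventually.of_forall fun w => ?_)
    simp only [k, inner_smul_left, inner_smul_right, RCLike.conj_to_real]
  have hsl : ∀ᵐ X : Conf N, MemLp (fun t => Ψ (Function.update X j t)) 2 volume := by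
    have hF := (memLp_insertAt j hΨ).comp_measurePreserving
      (Measure.measurePreserving_swap (μ := (volume : Measure ({l : Fin N // l ≠ j} → E3)))
        (ν := (volume : Measure E3)))
    have h1 := Measure.quasiMeasurePreserving_snd (μ := (volume : Measure E3)).ae
      (ae_memLp_slice hF)
    filter_upwards [(measurePreserving_splitAt j).quasiMeasurePreserving.ae h1] with X hX
    have hX' : MemLp (fun t => Ψ (insertAt j t fun l => X l)) 2 volume := hX
    convert hX' using 3 with t
    rw [← update_insertAt j (X j), insertAt_restrict]
  have h1 : ∫ X, inner ℝ (slotProj φ Ψ i X) (slotProj φ Ψ j X)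
      = ∫ w, k w ∂((volume : Measure (Conf N)).prod volume) := by
    rw [integral_prod _ hk]
    refine integral_congr_ae ?_
    filter_upwards [hsl] with X hX
    have hint : Integrable (fun t => φ t • Ψ (Function.update X j t)) :=
      integrable_of_norm_le_mul hφ hX (hφ.1.smul hX.1) fun x => (norm_smul _ _).le
    simp only [k]
    have h := integral_inner (𝕜 := ℝ) (hint.smul (φ (X j))) (slotProj φ Ψ i X)
    simp only [Pi.smul_apply, integral_smul] at h
    exact h.symm
  have hup : ∀ (X : Conf N) (t : E3), Ψ (Function.update (Function.update X i t) j (X i))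
      = - Ψ (Function.update X j t) := by
    intro X t
    have := ha (Equiv.swap i j) (Function.update X j t)
    rw [Equiv.Perm.sign_swap hij] at this
    have e : (fun l => Function.update X j t (Equiv.swap i j l))
        = Function.update (Function.update X i t) j (X i) := by
      ext1 l
      by_cases h1 : l = j
      · subst h1
        simp [Function.update_of_ne hij]
      · by_cases h2 : l = i
        · subst h2
          simp [Function.update_of_ne hij]
        · rw [Equiv.swap_apply_of_ne_of_ne h2 h1, Function.update_of_ne h1,
            Function.update_of_ne h1, Function.update_of_ne h2]
    rw [e] at this
    simpa using this
  have h2 : ∫ w, k w ∂((volume : Measure (Conf N)).prod volume)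
      = - ∫ w, k w ∂((volume : Measure (Conf N)).prod volume) := by
    conv_lhs => rw [← (measurePreserving_exchange i).integral_comp
      (measurableEmbedding_exchange i) k]
    rw [← integral_neg]
    refine integral_congr_ae (Filter.Eventually.of_forall fun w => ?_)
    have hC : partialPairing φ Ψ i (Function.update w.1 i w.2) = partialPairing φ Ψ i w.1 := by
      simp only [partialPairing, Function.update_idem]
    simp only [k, slotProj, hC, hup, Function.update_self, Function.update_of_ne hij.symm,
      inner_smul_left, inner_smul_right, inner_neg_right, RCLike.conj_to_real]
    ring
  rw [h1]
  linarith

/-- The Pauli principle: the one-particle density matrix of a normalized antisymmetric function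
is at most one. -/
theorem card_mul_integral_norm_sq_pairing_le
    (ha : ∀ (σ : Equiv.Perm (Fin N)) (X : Conf N),
      Ψ (fun j => X (σ j)) = ((Equiv.Perm.sign σ : ℤ) : ℂ) * Ψ X)
    (hφ : MemLp φ 2 volume) (hΨ : MemLp Ψ 2 volume) (h1 : ∫ X, ‖Ψ X‖ ^ 2 = 1) (i : Fin N) :
    N * ∫ z : {j : Fin N // j ≠ i} → E3, ‖∫ t, φ t • Ψ (insertAt i t z)‖ ^ 2
      ≤ ∫ x, φ x ^ 2 := by
  set m := ∫ z : {j : Fin N // j ≠ i} → E3, ‖∫ t, φ t • Ψ (insertAt i t z)‖ ^ 2 with hm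
  set q := ∫ x, φ x ^ 2 with hq
  have hf := memLp_slotProj hφ hΨ
  let P : Lp ℂ 2 (volume : Measure (Conf N)) := hΨ.toLp _
  let f : Fin N → Lp ℂ 2 (volume : Measure (Conf N)) := fun l => (hf l).toLp _
  have hinner : ∀ {a b : Conf N → ℂ} (ha : MemLp a 2 volume) (hb : MemLp b 2 volume),
      inner ℝ (ha.toLp a) (hb.toLp b) = ∫ X, inner ℝ (a X) (b X) := by
    intro a b ha hb
    rw [L2.inner_def]
    refine integral_congr_ae ?_
    filter_upwards [ha.coeFn_toLp, hb.coeFn_toLp] with X e1 e2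
    rw [e1, e2]
  have hPi : ∀ l, inner ℝ P (f l) = m := by
    intro l
    have e1 : inner ℝ P (f l) = ∫ X, inner ℝ (Ψ X) (slotProj φ Ψ l X) := hinner _ _
    rw [e1, hm, ← integral_inner_slotProj hφ hΨ i,
      ← integral_perm (Equiv.swap i l) (fun X => inner ℝ (Ψ X) (slotProj φ Ψ i X))]
    refine integral_congr_ae (Filter.Eventually.of_forall fun X => ?_)
    simp only [ha, slotProj_perm ha, Equiv.swap_apply_left]
    rcases Int.units_eq_one_or (Equiv.Perm.sign (Equiv.swap i l)) with h | h <;> simp [h]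
  have hff : ∀ l l', inner ℝ (f l) (f l') = if l = l' then q * m else 0 := by
    intro l l'
    have e1 : inner ℝ (f l) (f l') = ∫ X, inner ℝ (slotProj φ Ψ l X) (slotProj φ Ψ l' X) :=
      hinner _ _
    split_ifs with h
    · subst h
      rw [e1]
      simp only [real_inner_self_eq_norm_sq]
      rw [integral_norm_sq_slotProj, ← integral_inner_slotProj hφ hΨ l, ← hPi l]
      congr 1
      exact (hinner _ _).symm
    · rw [e1, integral_inner_slotProj_ne ha hφ hΨ h]
  have hP : inner ℝ P P = 1 := by
    rw [← h1]
    refine (hinner _ _).trans ?_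
    simp only [real_inner_self_eq_norm_sq]
  -- Cauchy–Schwarz between Ψ and the sum of its N orthogonal projections reads (N m)² ≤ N q m.
  have hcs := real_inner_mul_inner_self_le P (∑ l, f l)
  have e1 : inner ℝ P (∑ l, f l) = N * m := by
    rw [inner_sum]; simp [hPi]
  have e2 : inner ℝ (∑ l, f l) (∑ l, f l) = N * (q * m) := by
    rw [sum_inner]
    simp [inner_sum, hff]
  rw [e1, e2, hP, one_mul] at hcs
  have hq0 : 0 ≤ q := integral_nonneg fun x => sq_nonneg _
  by_contra! hlt
  nlinarith

end Pauli

/-! ### Densities and the many-body energy -/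

section Density

variable {N : ℕ} {Ψ : Conf N → ℂ}

/-- The position density of particle `i`. -/
def marginal (Ψ : Conf N → ℂ) (i : Fin N) (x : E3) : ℝ :=
  ∫ z : {j : Fin N // j ≠ i} → E3, ‖Ψ (insertAt i x z)‖ ^ 2

theorem density_eq_sum_marginal (Ψ : Conf N → ℂ) (x : E3) :
    density Ψ x = ∑ i, marginal Ψ i x := rfl

theorem marginal_nonneg (Ψ : Conf N → ℂ) (i : Fin N) (x : E3) : 0 ≤ marginal Ψ i x :=
  integral_nonneg fun _ => sq_nonneg _

theorem density_nonneg (Ψ : Conf N → ℂ) (x : E3) : 0 ≤ density Ψ x :=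
  Finset.sum_nonneg fun i _ => marginal_nonneg Ψ i x

theorem marginal_le_density (Ψ : Conf N → ℂ) (i : Fin N) (x : E3) :
    marginal Ψ i x ≤ density Ψ x :=
  Finset.single_le_sum (f := fun i => marginal Ψ i x) (fun i _ => marginal_nonneg Ψ i x)
    (Finset.mem_univ i)

theorem integrable_norm_sq_insertAt (hΨ : MemLp Ψ 2 volume) (i : Fin N) :
    Integrable (fun w : E3 × ({j : Fin N // j ≠ i} → E3) => ‖Ψ (insertAt i w.1 w.2)‖ ^ 2)
      (volume.prod volume) :=
  (memLp_two_iff_integrable_sq_norm (memLp_insertAt i hΨ).1).1 (memLp_insertAt i hΨ)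

theorem integrable_marginal (hΨ : MemLp Ψ 2 volume) (i : Fin N) : Integrable (marginal Ψ i) :=
  (integrable_norm_sq_insertAt hΨ i).integral_prod_left

theorem integrable_density (hΨ : MemLp Ψ 2 volume) : Integrable (density Ψ) :=
  integrable_finsetSum _ fun i _ => integrable_marginal hΨ i

theorem integrable_mul_norm_sq (hΨ : MemLp Ψ 2 volume) (i : Fin N) {w : E3 → ℝ}
    (hw : Measurable w) (hi : Integrable fun x => w x * marginal Ψ i x) :
    Integrable fun X : Conf N => w (X i) * ‖Ψ X‖ ^ 2 := by
  rw [← (measurePreserving_insertAt i).integrable_comp_emb (measurableEmbedding_insertAt i)]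
  have hm := (integrable_norm_sq_insertAt hΨ i)
  have hmm : AEStronglyMeasurable ((fun X : Conf N => w (X i) * ‖Ψ X‖ ^ 2) ∘
      fun w : E3 × ({j : Fin N // j ≠ i} → E3) => insertAt i w.1 w.2) (volume.prod volume) := by
    have h1 : AEStronglyMeasurable (fun v : E3 × ({j : Fin N // j ≠ i} → E3) => w v.1)
      (volume.prod volume) := (hw.comp measurable_fst).aestronglyMeasurable
    refine (h1.mul hm.1).congr (Filter.Eventually.of_forall fun v => ?_)
    simp
  rw [integrable_prod_iff hmm]
  constructor
  · filter_upwards [hm.prod_right_ae] with x hx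
    simpa using hx.const_mul (w x)
  · refine hi.norm.congr (Filter.Eventually.of_forall fun x => ?_)
    simp only [Function.comp_apply, insertAt_self, norm_mul, integral_const_mul,
      Real.norm_of_nonneg (marginal_nonneg Ψ i x), norm_pow, norm_norm]
    rfl

theorem integral_mul_norm_sq (i : Fin N) {w : E3 → ℝ}
    (hi : Integrable fun X : Conf N => w (X i) * ‖Ψ X‖ ^ 2) :
    ∫ X : Conf N, w (X i) * ‖Ψ X‖ ^ 2 = ∫ x, w x * marginal Ψ i x := by
  rw [integral_conf_iterated i hi]
  simp only [insertAt_self, integral_const_mul, marginal]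

theorem integral_marginal (hΨ : MemLp Ψ 2 volume) (i : Fin N) :
    ∫ x, marginal Ψ i x = ∫ X, ‖Ψ X‖ ^ 2 :=
  (integral_conf_iterated i ((memLp_two_iff_integrable_sq_norm hΨ.1).1 hΨ)).symm

theorem integral_density (hΨ : MemLp Ψ 2 volume) : ∫ x, density Ψ x = N * ∫ X, ‖Ψ X‖ ^ 2 := by
  simp only [density_eq_sum_marginal]
  rw [integral_finsetSum _ fun i _ => integrable_marginal hΨ i]
  simp [integral_marginal hΨ]

theorem marginal_congr {Ψ' : Conf N → ℂ} (h : Ψ =ᵐ[volume] Ψ') (i : Fin N) :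
    marginal Ψ i =ᵐ[volume] marginal Ψ' i := by
  have h1 := (measurePreserving_insertAt i).quasiMeasurePreserving.ae h
  filter_upwards [Measure.ae_ae_of_ae_prod h1] with x hx
  refine integral_congr_ae ?_
  filter_upwards [hx] with z hz
  rw [hz]

theorem density_congr {Ψ' : Conf N → ℂ} (h : Ψ =ᵐ[volume] Ψ') :
    density Ψ =ᵐ[volume] density Ψ' := by
  have := ae_all_iff.2 fun i => marginal_congr h i
  filter_upwards [this] with x hx
  simp only [density_eq_sum_marginal, hx]

/-- Integrated over any measurable set, the two marginals agree by swapping i and j, which alters Ψ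
only by a sign. -/
theorem marginal_ae_eq_of_antisymm (hΨ : MemLp Ψ 2 volume)
    (ha : ∀ (σ : Equiv.Perm (Fin N)) (X : Conf N),
      Ψ (fun j => X (σ j)) = ((Equiv.Perm.sign σ : ℤ) : ℂ) * Ψ X) (i j : Fin N) :
    marginal Ψ i =ᵐ[volume] marginal Ψ j := by
  have hsq := (memLp_two_iff_integrable_sq_norm hΨ.1).1 hΨ
  refine (integrable_marginal hΨ i).ae_eq_of_forall_setIntegral_eq _ _
    (integrable_marginal hΨ j) fun s hs _ => ?_
  have key : ∀ l, ∫ x in s, marginal Ψ l x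
      = ∫ X : Conf N, s.indicator 1 (X l) * ‖Ψ X‖ ^ 2 := by
    intro l
    have e : ∀ x, s.indicator (1 : E3 → ℝ) x * marginal Ψ l x = s.indicator (marginal Ψ l) x := by
      intro x
      by_cases hx : x ∈ s <;> simp [hx]
    rw [integral_mul_norm_sq l]
    · simp only [e]
      rw [integral_indicator hs]
    · refine integrable_mul_norm_sq hΨ l (measurable_one.indicator hs) ?_
      simp only [e]
      exact (integrable_marginal hΨ l).indicator hs
  rw [key, key, ← integral_perm (Equiv.swap i j)]
  refine integral_congr_ae (Filter.Eventually.of_forall fun X => ?_)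
  simp only [ha, norm_mul, norm_sign, one_mul, Equiv.swap_apply_left]

theorem density_ae_eq_of_antisymm (hΨ : MemLp Ψ 2 volume)
    (ha : ∀ (σ : Equiv.Perm (Fin N)) (X : Conf N),
      Ψ (fun j => X (σ j)) = ((Equiv.Perm.sign σ : ℤ) : ℂ) * Ψ X) (i : Fin N) :
    density Ψ =ᵐ[volume] fun x => N * marginal Ψ i x := by
  filter_upwards [ae_all_iff.2 fun j => marginal_ae_eq_of_antisymm hΨ ha j i] with x hx
  simp [density_eq_sum_marginal, hx]

theorem measurable_coulomb {K : ℕ} (y : Fin K → E3) : Measurable (coulomb y) := by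
  unfold coulomb
  fun_prop

theorem integrable_coulomb_mul_marginal {K : ℕ} (y : Fin K → E3) (hΨ : MemLp Ψ 2 volume)
    (h3 : Integrable fun x => density Ψ x ^ 3) (i : Fin N) :
    Integrable fun x => coulomb y x * marginal Ψ i x := by
  refine integrable_coulomb_mul y (marginal_nonneg Ψ i) (integrable_marginal hΨ i) ?_
  refine h3.mono' ((integrable_marginal hΨ i).1.pow 3) (Filter.Eventually.of_forall fun x => ?_)
  rw [Real.norm_of_nonneg (pow_nonneg (marginal_nonneg Ψ i x) 3)]
  exact pow_le_pow_left₀ (marginal_nonneg Ψ i x) (marginal_le_density Ψ i x) 3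

/-- The energy of a state in terms of its kinetic energy and its density. -/
theorem manyBodyEnergy_eq {K : ℕ} (p α : ℝ) (y : Fin K → E3) (hΨ : MemH1 Ψ)
    (h3 : Integrable fun x => density Ψ x ^ 3) :
    manyBodyEnergy p α y Ψ
      = (∑ a : Fin 3, ∑ i : Fin N, ∫ X, ‖weakDeriv Ψ (confDir i a) X‖ ^ 2)
        + (∫ x, coulomb y x * density Ψ x) - α ^ (2 * p - 2) / p * ∫ x, density Ψ x ^ p := by
  unfold manyBodyEnergy
  congr 1
  have hk : ∀ i a, Integrable fun X => ‖weakDeriv Ψ (confDir i a) X‖ ^ 2 := fun i a =>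
    (memLp_two_iff_integrable_sq_norm (hΨ.weakDeriv_spec _).1.1).1 (hΨ.weakDeriv_spec _).1
  have hm := fun i => integrable_coulomb_mul_marginal y hΨ.1 h3 i
  have hp := fun i => integrable_mul_norm_sq hΨ.1 i (measurable_coulomb y) (hm i)
  have h1 : ∀ i, ∫ X : Conf N,
      ((∑ a : Fin 3, ‖weakDeriv Ψ (confDir i a) X‖ ^ 2) + coulomb y (X i) * ‖Ψ X‖ ^ 2)
      = (∑ a, ∫ X, ‖weakDeriv Ψ (confDir i a) X‖ ^ 2) + ∫ x, coulomb y x * marginal Ψ i x := by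
    intro i
    rw [integral_add (integrable_finsetSum _ fun a _ => hk i a) (hp i),
      integral_finsetSum _ fun a _ => hk i a, integral_mul_norm_sq i (hp i)]
  simp only [h1, Finset.sum_add_distrib]
  congr 1
  · exact Finset.sum_comm
  · simp only [density_eq_sum_marginal, Finset.mul_sum]
    rw [integral_finsetSum Finset.univ fun i _ => hm i]

/-- A fermionic state has a representative that is antisymmetric everywhere. -/
theorem IsFermionicState.exists_antisymm (h : IsFermionicState Ψ) :
    ∃ Ψ' : Conf N → ℂ, Ψ =ᵐ[volume] Ψ' ∧ ∀ (σ : Equiv.Perm (Fin N)) (X : Conf N),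
      Ψ' (fun j => X (σ j)) = ((Equiv.Perm.sign σ : ℤ) : ℂ) * Ψ' X := by
  -- The antisymmetrisation of Ψ. An identity valid everywhere is needed because the Pauli argument
  -- evaluates Ψ at updated configurations.
  refine ⟨fun X => (Nat.factorial N : ℂ)⁻¹ *
    ∑ σ : Equiv.Perm (Fin N), ((Equiv.Perm.sign σ : ℤ) : ℂ) * Ψ (fun j => X (σ j)), ?_, ?_⟩
  · filter_upwards [ae_all_iff.2 h.antisymm] with X hX
    have hN : (Nat.factorial N : ℂ) ≠ 0 := by exact_mod_cast Nat.factorial_ne_zero N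
    simp only [hX, ← mul_assoc, sign_mul_sign, one_mul]
    rw [Finset.sum_const, Finset.card_univ, Fintype.card_perm, Fintype.card_fin, nsmul_eq_mul,
      inv_mul_cancel_left₀ hN]
  · intro τ X
    rw [mul_left_comm]
    refine congrArg _ ?_
    rw [Finset.mul_sum]
    refine Fintype.sum_equiv (Equiv.mulLeft τ) _ _ fun σ => ?_
    simp only [Equiv.coe_mulLeft, Equiv.Perm.sign_mul, Equiv.Perm.mul_apply, Units.val_mul,
      Int.cast_mul, ← mul_assoc, sign_mul_sign, one_mul]

end Density

/-! ### Natural orbitals -/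

section NaturalOrbitals

variable {N : ℕ}

theorem IsFermionicState.congr {Ψ Ψ' : Conf N → ℂ} (h : IsFermionicState Ψ)
    (he : Ψ =ᵐ[volume] Ψ') : IsFermionicState Ψ' := by
  refine ⟨h.memH1.congr he, fun σ => ?_, ?_⟩
  · filter_upwards [h.antisymm σ, he, (measurePreserving_perm σ).quasiMeasurePreserving.ae he]
      with X h1 h2 h3
    rw [← h3, ← h2, h1]
  · rw [← h.normalized]
    refine integral_congr_ae ?_
    filter_upwards [he] with X hX
    rw [hX]

theorem inner_integral_le {Z : Type*} [MeasurableSpace Z] {ν : Measure Z} {c : Z → ℂ}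
    (hc : MemLp c 2 ν) (b : Lp ℂ 2 ν) :
    (∫ z, inner ℝ (c z) (b z) ∂ν) ^ 2 ≤ (∫ z, ‖c z‖ ^ 2 ∂ν) * ‖b‖ ^ 2 := by
  have h1 : ∫ z, inner ℝ (c z) (b z) ∂ν = inner ℝ (hc.toLp c) b := by
    rw [L2.inner_def]
    refine integral_congr_ae ?_
    filter_upwards [hc.coeFn_toLp] with z hz
    rw [hz]
  have h2 : ∫ z, ‖c z‖ ^ 2 ∂ν = inner ℝ (hc.toLp c) (hc.toLp c) := by
    rw [L2.inner_def]
    refine integral_congr_ae ?_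
    filter_upwards [hc.coeFn_toLp] with z hz
    rw [hz, real_inner_self_eq_norm_sq]
  rw [h1, h2, ← real_inner_self_eq_norm_sq b, sq]
  exact real_inner_mul_inner_self_le _ _

/-- The spectral decomposition of the real part of the one-particle density matrix of a fermionic
state. -/
theorem IsFermionicState.exists_natural_orbitals {Ψ : Conf N → ℂ} (h : IsFermionicState Ψ)
    (i₀ : Fin N) :
    ∃ (ι : Type) (_ : Countable ι) (v : ι → E3 → ℝ) (d : Fin 3 → ι → E3 → ℝ),
      (∀ j, MemLp (v j) 2 volume) ∧ (∀ a j, MemLp (d a j) 2 volume) ∧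
      (∀ a j, HasWeakDeriv (v j) (d a j) (dir a)) ∧
      (∀ i j, i ≠ j → ∫ x, v i x * v j x = 0) ∧
      (∀ j, ∫ x, v j x ^ 2 ≤ 1) ∧
      (∀ᵐ x, HasSum (fun j => v j x ^ 2) (density Ψ x)) ∧
      (∀ a, HasSum (fun j => ∫ x, d a j x ^ 2)
        (∑ i, ∫ X, ‖weakDeriv Ψ (confDir i a) X‖ ^ 2)) := by
  obtain ⟨Ψ', he, ha⟩ := h.exists_antisymm
  have h' := h.congr he
  have hL := h'.memH1.1
  -- With the factor √N the squared kernel integrates over the other particles to N times a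
  -- marginal, that is, to the density.
  set r : ℝ := √N with hr
  have hr2 : r ^ 2 = N := Real.sq_sqrt (Nat.cast_nonneg N)
  have hΦ : MemLp (fun X => r • Ψ' X) 2 volume := hL.const_smul r
  have hF := memLp_insertAt i₀ hΦ
  have : Fact ((2 : ENNReal) ≠ ⊤) := ⟨by norm_num⟩
  have hsep := Lp.SecondCountableTopology (E := ℂ) (p := 2)
    (μ := (volume : Measure ({j : Fin N // j ≠ i₀} → E3)))
  have := @TopologicalSpace.SecondCountableTopology.to_separableSpace _ _ hsep
  obtain ⟨ι, hι, b, hb⟩ := exists_hilbertBasis_contr_orthogonal hF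
  have hg := fun a => (h'.memH1.weakDeriv_spec (confDir i₀ a))
  have hgr : ∀ a, MemLp (fun X => r • weakDeriv Ψ' (confDir i₀ a) X) 2 volume :=
    fun a => (hg a).1.const_smul r
  have hG := fun a => memLp_insertAt i₀ (hgr a)
  have hv := fun j => memLp_contr hF (Lp.memLp (b j))
  refine ⟨ι, hι, fun j => contr volume (fun w => r • Ψ' (insertAt i₀ w.1 w.2)) (b j),
    fun a j => contr volume (fun w => r • weakDeriv Ψ' (confDir i₀ a) (insertAt i₀ w.1 w.2)) (b j),
    hv, fun a j => memLp_contr (hG a) (Lp.memLp (b j)),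
    fun a j => ((hg a).2.const_smul r).contr hΦ (hgr a) (Lp.memLp (b j)), hb, fun j => ?_, ?_,
    fun a => ?_⟩
  -- With v = T b_j and n = ‖v‖²: n² = ⟨T*v, b_j⟩² ≤ ‖T*v‖² ≤ n, the last step being the Pauli bound
  -- at v. Hence n ≤ 1.
  · set v := contr volume (fun w => r • Ψ' (insertAt i₀ w.1 w.2)) (b j) with hvdef
    have h1 : ∫ x, v x ^ 2 = ∫ z, inner ℝ (∫ x, v x • r • Ψ' (insertAt i₀ x z)) (b j z) := by
      rw [← integral_mul_contr hF (hv j) (Lp.memLp (b j))]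
      simp only [sq]
      rfl
    have h2 := inner_integral_le (memLp_integral_smul hF (hv j)) (b j)
    have h3 := card_mul_integral_norm_sq_pairing_le ha (hv j) hL h'.normalized i₀
    have h4 : ∫ z, ‖∫ x, v x • r • Ψ' (insertAt i₀ x z)‖ ^ 2
        = N * ∫ z, ‖∫ x, v x • Ψ' (insertAt i₀ x z)‖ ^ 2 := by
      rw [← integral_const_mul]
      refine integral_congr_ae (Filter.Eventually.of_forall fun z => ?_)
      simp only [smul_comm _ r, integral_smul, norm_smul, mul_pow, Real.norm_eq_abs, sq_abs, hr2]
    rw [← h1, b.orthonormal.1 j, h4, one_pow, mul_one] at h2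
    have h5 := h2.trans h3
    have h0 : 0 ≤ ∫ x, v x ^ 2 := integral_nonneg fun x => sq_nonneg _
    by_contra! hlt
    nlinarith
  · filter_upwards [hasSum_contr_sq hF b, density_congr he, density_ae_eq_of_antisymm hL ha i₀]
      with x h1 h2 h3
    rw [h2, h3]
    simp only [norm_smul, mul_pow, Real.norm_eq_abs, sq_abs, hr2, integral_const_mul] at h1
    exact h1
  -- Parseval for the differentiated kernel holds in any basis, so the basis adapted to Ψ serves
  -- here too.
  · have h1 := hasSum_integral_contr_sq (hG a) b
    have h2 : ∑ i, ∫ X, ‖weakDeriv Ψ (confDir i a) X‖ ^ 2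
        = N * ∫ X, ‖weakDeriv Ψ' (confDir i₀ a) X‖ ^ 2 := by
      have : ∀ i, ∫ X, ‖weakDeriv Ψ (confDir i a) X‖ ^ 2
          = ∫ X, ‖weakDeriv Ψ' (confDir i₀ a) X‖ ^ 2 := fun i => by
        have := integral_norm_sq_weakDeriv_perm h'.memH1 (Equiv.swap i₀ i) (h'.antisymm _) i₀ a
        rw [Equiv.swap_apply_left] at this
        rw [weakDeriv_congr he, this]
      simp [this]
    have hsq := (memLp_two_iff_integrable_sq_norm (hg a).1.1).1 (hg a).1
    rw [h2, integral_conf_iterated i₀ hsq]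
    simp only [norm_smul, mul_pow, Real.norm_eq_abs, sq_abs, hr2, integral_const_mul] at h1
    exact h1

end NaturalOrbitals

/-! ### Selecting occupied orbitals -/

/-- Among occupation numbers `n j ∈ [0, 1]` with total `N`, the total energy is nearly attained by
occupying `N` states fully. -/
theorem exists_finset_card_sum_le {ι : Type*} {n e : ι → ℝ} {N : ℕ} {S ε : ℝ} (hN : 0 < N)
    (h0 : ∀ j, 0 ≤ n j) (h1 : ∀ j, n j ≤ 1) (hn : HasSum n N) (he : HasSum e S)
    (hz : ∀ j, n j = 0 → 0 ≤ e j) (hε : 0 < ε) :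
    ∃ I : Finset ι, I.card = N ∧ (∀ j ∈ I, 0 < n j) ∧ ∑ j ∈ I, e j / n j ≤ S + ε := by
  classical
  by_contra! hcon
  set A : Set (Finset ι) := {I | I.card = N ∧ ∀ j ∈ I, 0 < n j} with hA
  -- Finitely many indices carry mass above N - 1 with each n_j ≤ 1, so at least N of them are
  -- occupied.
  have hne : A.Nonempty := by
    obtain ⟨s, hs⟩ : ∃ s : Finset ι, (N : ℝ) - 1 < ∑ j ∈ s, n j :=
      ((hn.eventually (lt_mem_nhds (by linarith : (N : ℝ) - 1 < N))).exists)
    have hs' : ∑ j ∈ s, n j ≤ (s.filter fun j => 0 < n j).card := by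
      rw [← Finset.sum_filter_of_ne (p := fun j => 0 < n j)
        fun j _ hj => (h0 j).lt_of_ne hj.symm]
      calc _ ≤ ∑ j ∈ s.filter fun j => 0 < n j, (1 : ℝ) := Finset.sum_le_sum fun j _ => h1 j
        _ = _ := by simp
    have hcard : N ≤ (s.filter fun j => 0 < n j).card := by
      have : (N : ℝ) < (s.filter fun j => 0 < n j).card + 1 := by linarith
      exact Nat.lt_succ_iff.1 (by exact_mod_cast this)
    obtain ⟨I, hI, hc⟩ := Finset.exists_subset_card_eq hcard
    exact ⟨I, hc, fun j hj => (Finset.mem_filter.1 (hI hj)).2⟩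
  set f : Finset ι → ℝ := fun I => ∑ j ∈ I, e j / n j with hf
  -- The negated conclusion itself provides the lower bound.
  have hbdd : BddBelow (f '' A) := ⟨S + ε, by
    rintro _ ⟨I, hI, rfl⟩
    exact (hcon I hI.1 hI.2).le⟩
  have hNpos : (0 : ℝ) < N := by exact_mod_cast hN
  -- The infimum need not be attained; N errors of size δ will add up to ε.
  set δ : ℝ := ε / N with hδ
  have hδ0 : 0 < δ := by positivity
  obtain ⟨_, ⟨I, hI, rfl⟩, hlt⟩ := Real.lt_sInf_add_pos (hne.image f) hδ0
  have hmin : ∀ I' ∈ A, f I < f I' + δ := fun I' hI' =>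
    hlt.trans_le (by linarith [csInf_le hbdd ⟨I', hI', rfl⟩])
  have hIne : I.Nonempty := Finset.card_pos.1 (hI.1 ▸ hN)
  obtain ⟨m, hmI, hmax⟩ := I.exists_max_image (fun j => e j / n j) hIne
  set lam := e m / n m with hlam
  -- Exchange argument: replacing the most expensive state m of I by k lowers the cost by less than
  -- δ.
  have hout : ∀ k ∉ I, 0 < n k → lam - δ ≤ e k / n k := by
    intro k hk hnk
    have hk' : k ∉ I.erase m := fun h => hk (Finset.mem_of_mem_erase h)
    have hmem : insert k (I.erase m) ∈ A := by
      refine ⟨?_, ?_⟩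
      · rw [Finset.card_insert_of_notMem hk', Finset.card_erase_of_mem hmI, hI.1]; omega
      · intro j hj
        rcases Finset.mem_insert.1 hj with rfl | hj
        · exact hnk
        · exact hI.2 j (Finset.mem_of_mem_erase hj)
    have := hmin _ hmem
    simp only [hf] at this
    rw [Finset.sum_insert hk', ← Finset.add_sum_erase I _ hmI] at this
    linarith
  have hsum : HasSum (fun j => e j - n j * (lam - δ)) (S - N * (lam - δ)) :=
    he.sub (hn.mul_right _)
  have hnonneg : ∀ j ∉ I, 0 ≤ e j - n j * (lam - δ) := by
    intro j hj
    rcases (h0 j).eq_or_lt with h | h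
    · rw [← h]; simpa using hz j h.symm
    · have := hout j hj h
      rw [le_div_iff₀ h] at this
      linarith
  have h2 := sum_le_hasSum I (fun j hj => hnonneg j hj) hsum
  -- Termwise this is (1 - n_j)(λ - e_j/n_j) + n_j δ ≥ 0, where n_j ≤ 1 and e_j/n_j ≤ λ on I.
  have h3 : ∑ j ∈ I, (e j / n j - δ - (lam - δ)) ≤ ∑ j ∈ I, (e j - n j * (lam - δ)) := by
    refine Finset.sum_le_sum fun j hj => ?_
    have hp := hI.2 j hj
    have hq := hmax j hj
    have e1 : e j = n j * (e j / n j) := by field_simp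
    have := h1 j
    rw [e1, mul_div_cancel_left₀ _ hp.ne']
    nlinarith [mul_nonneg (sub_nonneg.2 this) (sub_nonneg.2 hq), mul_nonneg hp.le hδ0.le]
  have h4 : ∑ j ∈ I, (e j / n j - δ - (lam - δ)) = f I - N * δ - N * (lam - δ) := by
    rw [Finset.sum_sub_distrib, Finset.sum_sub_distrib]
    simp [hI.1, hf]
    ring
  have h5 : N * δ = ε := by rw [hδ]; field_simp
  have := hcon I hI.1 hI.2
  simp only [hf] at h4
  linarith

/-! ### The lower bound on the many-body energy -/

theorem e3_eq_sum (v : E3) : v = ∑ a, v a • dir a := by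
  have := (EuclideanSpace.basisFun (Fin 3) ℝ).sum_repr v
  simpa [dir] using this.symm

theorem memH1_of_dir {u : E3 → ℝ} (h : MemLp u 2 volume) {g : Fin 3 → E3 → ℝ}
    (hg : ∀ a, MemLp (g a) 2 volume) (hw : ∀ a, HasWeakDeriv u (g a) (dir a)) : MemH1 u := by
  refine ⟨h, fun v => ?_⟩
  rw [e3_eq_sum v]
  exact ⟨fun x => ∑ a, v a • g a x, memLp_finsetSum _ fun a _ => (hg a).const_smul (v a),
    HasWeakDeriv.sum_dir _ _ (h.locallyIntegrable (by norm_num))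
      (fun a _ => (hg a).locallyIntegrable (by norm_num)) fun a _ => hw a⟩

theorem eLpNorm_two_sq_eq {u : E3 → ℝ} (hu : MemLp u 2 volume) :
    eLpNorm u 2 volume ^ 2 = ENNReal.ofReal (∫ x, u x ^ 2) := by
  rw [ofReal_integral_eq_lintegral_ofReal hu.integrable_sq
    (Filter.Eventually.of_forall fun x => sq_nonneg _), eLpNorm_two_eq, ← ENNReal.rpow_natCast,
    ← ENNReal.rpow_mul]
  norm_num
  refine lintegral_congr fun x => ?_
  rw [← enorm_pow, Real.enorm_of_nonneg (sq_nonneg _)]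

theorem sq_add_sum_le (x : ENNReal) (s : Fin 3 → ENNReal) :
    (x + ∑ a, s a) ^ 2 ≤ 6 * (x ^ 2 + ∑ a, s a ^ 2) := by
  have h1 := ENNReal.rpow_add_le_mul_rpow_add_rpow x (∑ a, s a) (p := 2) (by norm_num)
  have h2 := ENNReal.rpow_sum_le_const_mul_sum_rpow Finset.univ s (p := 2) (by norm_num)
  norm_num at h1 h2
  refine h1.trans ?_
  calc _ ≤ 2 * (x ^ 2 + 3 * ∑ a, s a ^ 2) := by gcongr
    _ ≤ 2 * (3 * x ^ 2 + 3 * ∑ a, s a ^ 2) := by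
        gcongr
        calc x ^ 2 = 1 * x ^ 2 := (one_mul _).symm
          _ ≤ 3 * x ^ 2 := by gcongr; norm_num
    _ = _ := by rw [← mul_add, ← mul_assoc]; norm_num

/-- Superpositions of orbital densities with finite total `H¹` energy are in `L³`. -/
theorem integrable_cube_of_hasSum_weakDeriv {ι : Type*} [Countable ι] {v : ι → E3 → ℝ}
    {d : Fin 3 → ι → E3 → ℝ} {ρ : E3 → ℝ} (hv : ∀ j, MemLp (v j) 2 volume)
    (hd : ∀ a j, MemLp (d a j) 2 volume) (hw : ∀ a j, HasWeakDeriv (v j) (d a j) (dir a))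
    (hs : ∀ᵐ x, HasSum (fun j => v j x ^ 2) (ρ x)) (hρ : AEStronglyMeasurable ρ volume)
    (h0 : Summable fun j => ∫ x, v j x ^ 2) (h1 : ∀ a, Summable fun j => ∫ x, d a j x ^ 2) :
    Integrable fun x => ρ x ^ 3 := by
  obtain ⟨C, hC⟩ := exists_eLpNorm_six_le
  have h6 := fun j => hC (v j) (fun a => d a j) (hv j) (fun a => hd a j) (fun a => hw a j)
  have hmem : ∀ j, MemLp (v j) 6 volume := fun j => ⟨(hv j).1, (h6 j).trans_lt
    (ENNReal.mul_lt_top ENNReal.coe_lt_top (ENNReal.add_lt_top.2 ⟨(hv j).2,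
      ENNReal.sum_lt_top.2 fun a _ => (hd a j).2⟩))⟩
  refine integrable_cube_of_hasSum hmem hs ?_ hρ
  have hle : ∀ j, eLpNorm (v j) 6 volume ^ 2
      ≤ (C : ENNReal) ^ 2 * 6 * ENNReal.ofReal (∫ x, v j x ^ 2 + ∑ a, d a j x ^ 2) := by
    intro j
    have e : ENNReal.ofReal (∫ x, v j x ^ 2 + ∑ a, d a j x ^ 2)
        = eLpNorm (v j) 2 volume ^ 2 + ∑ a, eLpNorm (d a j) 2 volume ^ 2 := by
      rw [integral_add (hv j).integrable_sq (integrable_finsetSum _ fun a _ => (hd a j).integrable_sq),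
        integral_finsetSum _ fun a _ => (hd a j).integrable_sq,
        ENNReal.ofReal_add (integral_nonneg fun x => sq_nonneg _)
          (Finset.sum_nonneg fun a _ => integral_nonneg fun x => sq_nonneg _),
        ENNReal.ofReal_sum_of_nonneg fun a _ => integral_nonneg fun x => sq_nonneg _]
      simp only [eLpNorm_two_sq_eq (hv j), eLpNorm_two_sq_eq (hd _ j)]
    rw [e, mul_assoc]
    calc _ ≤ _ := pow_le_pow_left' (h6 j) 2
      _ = (C : ENNReal) ^ 2 * (eLpNorm (v j) 2 volume + ∑ a, eLpNorm (d a j) 2 volume) ^ 2 :=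
        mul_pow _ _ _
      _ ≤ _ := by gcongr; exact sq_add_sum_le _ _
  refine ((ENNReal.tsum_le_tsum hle).trans_lt ?_).ne
  rw [ENNReal.tsum_mul_left]
  refine ENNReal.mul_lt_top (by finiteness) ?_
  have hsum : Summable fun j => ∫ x, v j x ^ 2 + ∑ a, d a j x ^ 2 := by
    refine (h0.add (summable_sum fun a (_ : a ∈ Finset.univ) => h1 a)).congr fun j => ?_
    rw [integral_add (hv j).integrable_sq (integrable_finsetSum _ fun a _ => (hd a j).integrable_sq),
        integral_finsetSum _ fun a _ => (hd a j).integrable_sq]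
  exact hsum.tsum_ofReal_lt_top

theorem IsFermionicState.integrable_density_cube {N : ℕ} {Ψ : Conf N → ℂ}
    (h : IsFermionicState Ψ) (i₀ : Fin N) : Integrable fun x => density Ψ x ^ 3 := by
  obtain ⟨ι, hι, v, d, hv, hd, hw, -, -, hs, hk⟩ := h.exists_natural_orbitals i₀
  refine integrable_cube_of_hasSum_weakDeriv hv hd hw hs (integrable_density h.memH1.1).1 ?_
    fun a => (hk a).summable
  have := hasSum_integral_mul_of_hasSum (w := fun _ => 1) (fun j x => sq_nonneg (v j x))
    (fun j => (hv j).1.pow 2) hs aestronglyMeasurable_const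
    (by simpa using integrable_density h.memH1.1)
  simpa using this.summable

theorem integrable_sum_sq_cube {N : ℕ} {u : Fin N → E3 → ℝ} (hu : ∀ i, MemH1 (u i)) :
    Integrable fun x => (∑ i, u i x ^ 2) ^ 3 := by
  refine integrable_cube_of_hasSum (fun i => (hu i).memLp_six)
    (Filter.Eventually.of_forall fun x => hasSum_fintype _) ?_ ?_
  · rw [tsum_fintype]
    exact (ENNReal.sum_lt_top.2 fun i _ => ENNReal.pow_lt_top (hu i).memLp_six.2).ne
  · have : (fun x => ∑ i, u i x ^ 2) = ∑ i, fun x => u i x ^ 2 := by ext x; simp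
    rw [this]
    exact Finset.aestronglyMeasurable_sum _ fun i _ => (hu i).1.1.pow 2

/-- The tangent line inequality for `t ↦ t ^ p`. -/
theorem rpow_tangent_le {p s t : ℝ} (hp : 1 < p) (hs : 0 ≤ s) (ht : 0 ≤ t) :
    t ^ p + p * (t ^ (p - 1) * s) - p * t ^ p ≤ s ^ p := by
  rcases ht.eq_or_lt with h | h
  · rw [← h, Real.zero_rpow (by linarith), Real.zero_rpow (by linarith)]
    simpa using Real.rpow_nonneg hs p
  · have h1 := one_add_mul_self_le_rpow_one_add (s := s / t - 1)
      (by linarith [div_nonneg hs ht]) hp.le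
    have h2 : t ^ p * (1 + p * (s / t - 1)) ≤ t ^ p * (1 + (s / t - 1)) ^ p :=
      mul_le_mul_of_nonneg_left h1 (Real.rpow_nonneg ht p)
    rw [add_sub_cancel, Real.div_rpow hs ht, mul_div_cancel₀ _ (Real.rpow_pos_of_pos h p).ne'] at h2
    rw [Real.rpow_sub_one h.ne']
    calc _ = t ^ p * (1 + p * (s / t - 1)) := by field_simp; ring
      _ ≤ _ := h2

theorem HasWeakDeriv.ae_eq_weakDeriv {X F : Type*} [NormedAddCommGroup X] [NormedSpace ℝ X]
    [MeasureSpace X] [NormedAddCommGroup F] [NormedSpace ℝ F] [FiniteDimensional ℝ X]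
    [BorelSpace X] [CompleteSpace F] [IsLocallyFiniteMeasure (volume : Measure X)]
    {u g : X → F} {v : X} (hg : MemLp g 2 volume)
    (h : HasWeakDeriv u g v) : weakDeriv u v =ᵐ[volume] g := by
  have hex : ∃ g : X → F, MemLp g 2 volume ∧ HasWeakDeriv u g v := ⟨g, hg, h⟩
  have hs : MemLp (weakDeriv u v) 2 volume ∧ HasWeakDeriv u (weakDeriv u v) v := by
    rw [weakDeriv, dif_pos hex]
    exact hex.choose_spec
  exact HasWeakDeriv.ae_unique hs.1 hg hs.2 h

/-- The one-body energy of a multiple of a weakly differentiable function. -/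
theorem integral_oneBody_smul {K : ℕ} (y : Fin K → E3) {v : E3 → ℝ} {d : Fin 3 → E3 → ℝ}
    (hd : ∀ a, MemLp (d a) 2 volume) (hw : ∀ a, HasWeakDeriv v (d a) (dir a))
    (hV : Integrable fun x => coulomb y x * v x ^ 2) (s : ℝ) :
    ∫ x, ((∑ a, |weakDeriv (fun x => s * v x) (dir a) x| ^ 2) + coulomb y x * |s * v x| ^ 2)
      = s ^ 2 * ((∑ a, ∫ x, d a x ^ 2) + ∫ x, coulomb y x * v x ^ 2) := by
  have h1 : ∀ᵐ x, ∀ a, weakDeriv (fun x => s * v x) (dir a) x = s * d a x :=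
    ae_all_iff.2 fun a => HasWeakDeriv.ae_eq_weakDeriv ((hd a).const_mul s) ((hw a).const_smul s)
  have h2 : ∫ x, ((∑ a, |weakDeriv (fun x => s * v x) (dir a) x| ^ 2) + coulomb y x * |s * v x| ^ 2)
      = ∫ x, s ^ 2 * ((∑ a, d a x ^ 2) + coulomb y x * v x ^ 2) := by
    refine integral_congr_ae ?_
    filter_upwards [h1] with x hx
    simp only [hx, sq_abs, mul_pow, mul_add, Finset.mul_sum]
    ring
  rw [h2, integral_const_mul, integral_add (integrable_finsetSum _ fun a _ => (hd a).integrable_sq) hV,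
    integral_finsetSum _ fun a _ => (hd a).integrable_sq]

/-- Linearising the interaction at ρ assigns to v_j the energy e_j = A_j - c R_j, with Σ e_j = T +
∫Vρ - c∫ρ^p. Selecting N orbitals costs at most ε, and the constant terms of the tangent turn -c∫ρ^p
back into -(c/p)∫ρ^p. -/
theorem exists_orthonormalTuple_energy_le {N K : ℕ} (hN : 0 < N) {p α : ℝ} (hp : 1 < p)
    (hp3 : p ≤ 3) (hα : 0 < α) (y : Fin K → E3) {Ψ : Conf N → ℂ} (h : IsFermionicState Ψ)
    {ε : ℝ} (hε : 0 < ε) : ∃ u : Fin N → E3 → ℝ, IsOrthonormalTuple u ∧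
      orbitalEnergy p α y u ≤ manyBodyEnergy p α y Ψ + ε := by
  have h3 := h.integrable_density_cube ⟨0, hN⟩
  obtain ⟨ι, hι, v, d, hv, hd, hw, ho, hle, hs, hk⟩ := h.exists_natural_orbitals ⟨0, hN⟩
  rw [manyBodyEnergy_eq p α y h.memH1 h3]
  set ρ := density Ψ with hρ
  have hρ0 : ∀ x, 0 ≤ ρ x := density_nonneg Ψ
  have hρ1 : Integrable ρ := integrable_density h.memH1.1
  have hρp : Integrable fun x => ρ x ^ p := integrable_rpow hρ0 hρ1 h3 hp.le hp3
  have hρV : Integrable fun x => coulomb y x * ρ x := integrable_coulomb_mul y hρ0 hρ1 h3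
  have hpow : ∀ x, ρ x ^ (p - 1) * ρ x = ρ x ^ p := fun x => by
    rw [← Real.rpow_add_one' (hρ0 x) (by linarith), sub_add_cancel]
  have hρR : Integrable fun x => ρ x ^ (p - 1) * ρ x := by simpa only [hpow] using hρp
  have hRm : AEStronglyMeasurable (fun x => ρ x ^ (p - 1)) volume :=
    (hρ1.1.aemeasurable.pow_const _).aestronglyMeasurable
  have hv0 : ∀ j x, 0 ≤ v j x ^ 2 := fun j x => sq_nonneg _
  have hvm : ∀ j, AEStronglyMeasurable (fun x => v j x ^ 2) volume := fun j => (hv j).1.pow 2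
  set c : ℝ := α ^ (2 * p - 2) with hc
  have hc0 : 0 < c := Real.rpow_pos_of_pos hα _
  set n : ι → ℝ := fun j => ∫ x, v j x ^ 2 with hn
  set A : ι → ℝ := fun j => (∑ a, ∫ x, d a j x ^ 2) + ∫ x, coulomb y x * v j x ^ 2 with hA
  set R : ι → ℝ := fun j => ∫ x, ρ x ^ (p - 1) * v j x ^ 2 with hR
  have sn : HasSum n N := by
    have := hasSum_integral_mul_of_hasSum (w := fun _ => 1) hv0 hvm hs aestronglyMeasurable_const
      (by simpa using hρ1)
    simpa [hρ, integral_density h.memH1.1, h.normalized] using this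
  have hVm := (measurable_coulomb y).aestronglyMeasurable (μ := volume)
  have sV := hasSum_integral_mul_of_hasSum hv0 hvm hs hVm hρV
  have iV := integrable_mul_of_hasSum hv0 hvm hs hVm hρV
  have sR := hasSum_integral_mul_of_hasSum hv0 hvm hs hRm hρR
  have iR := integrable_mul_of_hasSum hv0 hvm hs hRm hρR
  simp only [hpow] at sR
  set T := ∑ a : Fin 3, ∑ i : Fin N, ∫ X, ‖weakDeriv Ψ (confDir i a) X‖ ^ 2 with hT
  have sT : HasSum (fun j => ∑ a, ∫ x, d a j x ^ 2) T := hasSum_sum fun a _ => hk a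
  have se := (sT.add sV).sub (sR.mul_left c)
  -- An orbital with n_j = 0 vanishes a.e., so only its nonnegative kinetic term can remain.
  have hz : ∀ j, n j = 0 → 0 ≤ A j - c * R j := by
    intro j hj
    have h1 := (integral_eq_zero_iff_of_nonneg (hv0 j) (hv j).integrable_sq).1 hj
    have h2 : ∀ w : E3 → ℝ, ∫ x, w x * v j x ^ 2 = 0 := fun w => by
      rw [integral_eq_zero_of_ae]
      filter_upwards [h1] with x hx
      simp only [Pi.zero_apply] at hx ⊢
      rw [hx, mul_zero]
    simp only [hA, hR, h2, mul_zero, add_zero, sub_zero]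
    exact Finset.sum_nonneg fun a _ => integral_nonneg fun x => sq_nonneg _
  obtain ⟨I, hIc, hIpos, hIle⟩ := exists_finset_card_sum_le hN
    (fun j => integral_nonneg (hv0 j)) hle sn se hz hε
  let σ := (I.equivFinOfCardEq hIc).symm
  have hsumσ : ∀ g : ι → ℝ, ∑ k, g (σ k) = ∑ j ∈ I, g j := fun g => by
    rw [← Finset.sum_coe_sort I g]
    exact Fintype.sum_equiv σ _ _ fun k => rfl
  have hnσ : ∀ k, 0 < n (σ k) := fun k => hIpos _ (σ k).2
  -- Normalisation of the selected orbitals; quadratic quantities acquire the factor 1/n_j required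
  -- by the selection lemma.
  let s : Fin N → ℝ := fun k => (√(n (σ k)))⁻¹
  have hs2 : ∀ k, s k ^ 2 = (n (σ k))⁻¹ := fun k => by
    simp only [s, inv_pow, Real.sq_sqrt (hnσ k).le]
  let u : Fin N → E3 → ℝ := fun k x => s k * v (σ k) x
  have huH : ∀ k, MemH1 (u k) := fun k => memH1_of_dir ((hv _).const_mul (s k))
    (fun a => (hd a (σ k)).const_mul (s k)) fun a => (hw a (σ k)).const_smul (s k)
  refine ⟨u, ⟨huH, fun k l => ?_⟩, ?_⟩
  · have e : ∀ x, u k x * u l x = (s k * s l) * (v (σ k) x * v (σ l) x) := fun x => by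
      simp only [u]; ring
    simp only [e, integral_const_mul]
    split_ifs with hkl
    · subst hkl
      have : ∫ x, v (σ k) x * v (σ k) x = n (σ k) := by simp only [hn, sq]
      rw [this, ← sq, hs2, inv_mul_cancel₀ (hnσ k).ne']
    · rw [ho _ _ fun hh => hkl (σ.injective (Subtype.ext hh)), mul_zero]
  · have hu3 := integrable_sum_sq_cube huH
    have hq0 : ∀ x, 0 ≤ ∑ k, u k x ^ 2 := fun x => Finset.sum_nonneg fun k _ => sq_nonneg _
    have hup : Integrable fun x => (∑ k, u k x ^ 2) ^ p :=
      integrable_rpow hq0 (integrable_finsetSum _ fun k _ => (huH k).1.integrable_sq) hu3 hp.le hp3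
    have hone : ∀ k, ∫ x, ((∑ a, |weakDeriv (u k) (dir a) x| ^ 2) + coulomb y x * |u k x| ^ 2)
        = A (σ k) / n (σ k) := fun k => by
      rw [div_eq_inv_mul, ← hs2]
      exact integral_oneBody_smul y (fun a => hd a (σ k)) (fun a => hw a (σ k)) (iV (σ k)) (s k)
    have hRu : ∀ x, ρ x ^ (p - 1) * ∑ k, u k x ^ 2
        = ∑ k, s k ^ 2 * (ρ x ^ (p - 1) * v (σ k) x ^ 2) := fun x => by
      rw [Finset.mul_sum]
      exact Finset.sum_congr rfl fun k _ => by simp only [u]; ring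
    have iRu : Integrable fun x => ρ x ^ (p - 1) * ∑ k, u k x ^ 2 := by
      simp only [hRu]
      exact integrable_finsetSum _ fun k _ => (iR (σ k)).const_mul _
    have eRu : ∫ x, ρ x ^ (p - 1) * ∑ k, u k x ^ 2 = ∑ k, R (σ k) / n (σ k) := by
      simp only [hRu]
      rw [integral_finsetSum _ fun k _ => (iR (σ k)).const_mul _]
      refine Finset.sum_congr rfl fun k _ => ?_
      rw [integral_const_mul, hs2, div_eq_inv_mul]
    have htan : (∫ x, ρ x ^ p) + p * (∑ k, R (σ k) / n (σ k)) - p * ∫ x, ρ x ^ p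
        ≤ ∫ x, (∑ k, u k x ^ 2) ^ p := by
      have iAdd : Integrable fun x => ρ x ^ p + p * (ρ x ^ (p - 1) * ∑ k, u k x ^ 2) :=
        hρp.add (iRu.const_mul p)
      rw [← eRu, ← integral_const_mul, ← integral_const_mul, ← integral_add hρp (iRu.const_mul p),
        ← integral_sub iAdd (hρp.const_mul p)]
      refine integral_mono (iAdd.sub (hρp.const_mul p)) hup fun x => ?_
      exact rpow_tangent_le hp (hq0 x) (hρ0 x)
    have hE : orbitalEnergy p α y u = (∑ k, A (σ k) / n (σ k))
        - c / p * ∫ x, (∑ k, u k x ^ 2) ^ p := by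
      unfold orbitalEnergy
      rw [Finset.sum_congr rfl fun k _ => hone k]
      simp only [sq_abs]
      rfl
    have hI2 : (∑ k, A (σ k) / n (σ k)) - c * ∑ k, R (σ k) / n (σ k)
        ≤ T + (∫ x, coulomb y x * ρ x) - c * (∫ x, ρ x ^ p) + ε := by
      refine le_trans (le_of_eq ?_) hIle
      rw [hsumσ (fun j => A j / n j), hsumσ (fun j => R j / n j), Finset.mul_sum,
        ← Finset.sum_sub_distrib]
      exact Finset.sum_congr rfl fun j _ => by simp only [hA, hR, hn]; ring
    have hp0 : 0 < p := by linarith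
    have h5 := mul_le_mul_of_nonneg_left htan (div_nonneg hc0.le hp0.le)
    have h6 : c / p * ((∫ x, ρ x ^ p) + p * (∑ k, R (σ k) / n (σ k)) - p * ∫ x, ρ x ^ p)
        = c / p * (∫ x, ρ x ^ p) + c * (∑ k, R (σ k) / n (σ k)) - c * ∫ x, ρ x ^ p := by
      field_simp
    rw [hE]
    linarith

/-- The fermionic ground state energy is bounded below by the orbital energy. -/
theorem orbitalInf_le_fermionicEnergy {N K : ℕ} (hN : 0 < N) {p α : ℝ} (hp : 1 < p)
    (hp3 : p ≤ 3) (hα : 0 < α) (y : Fin K → E3) :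
    orbitalInf N p α y ≤ fermionicEnergy N p α y := by
  refine le_iInf₂ fun Ψ hΨ => ?_
  refine le_of_forall_gt fun b hb => ?_
  obtain ⟨r, hr1, hr2⟩ := EReal.lt_iff_exists_real_btwn.1 hb
  have hr1' : manyBodyEnergy p α y Ψ < r := by exact_mod_cast hr1
  obtain ⟨u, hu, hle⟩ := exists_orthonormalTuple_energy_le hN hp hp3 hα y hΨ (sub_pos.2 hr1')
  refine lt_of_le_of_lt ((iInf₂_le u hu).trans ?_) hr2
  exact_mod_cast hle.trans (by linarith)

/-! ### Slater determinants -/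

theorem slaterDet_perm {N : ℕ} (u : Fin N → E3 → ℂ) (σ : Equiv.Perm (Fin N)) (X : Conf N) :
    slaterDet u (fun j => X (σ j)) = ((Equiv.Perm.sign σ : ℤ) : ℂ) * slaterDet u X := by
  have := Matrix.det_permute' σ (Matrix.of fun i j => u i (X j))
  unfold slaterDet
  rw [mul_left_comm, ← this]
  rfl

theorem fermionicEnergy_le_slaterInf (N : ℕ) {K : ℕ} (p α : ℝ) (y : Fin K → E3) :
    fermionicEnergy N p α y ≤ slaterInf N p α y := by
  refine le_iInf₂ fun Ψ h => iInf₂_le Ψ ⟨h.2.1, fun σ => ?_, h.2.2.2⟩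
  obtain ⟨u, -, -, hu⟩ := h.1
  filter_upwards [hu, (measurePreserving_perm σ).quasiMeasurePreserving.ae hu] with X h1 h2
  rw [h1, h2, slaterDet_perm]

/-! ### Products of orthonormal orbitals. -/

section OrthonormalProducts

variable {ι κ : Type*} [Fintype ι] {u : κ → E3 → ℝ}

theorem integrable_prod_mul_prod (hu : ∀ k, MemLp (u k) 2 volume) (a b : ι → κ) :
    Integrable fun z : ι → E3 => (∏ j, u (a j) (z j)) * ∏ j, u (b j) (z j) := by
  simp only [← Finset.prod_mul_distrib]
  exact Integrable.fintype_prod (f := fun j x => u (a j) x * u (b j) x)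
    fun j => memLp_two_mul (hu (a j)) (hu (b j))

theorem memLp_fintype_prod (hu : ∀ k, MemLp (u k) 2 volume) (a : ι → κ) :
    MemLp (fun z : ι → E3 => ((∏ j, u (a j) (z j) : ℝ) : ℂ)) 2 volume := by
  refine MemLp.ofReal ?_
  rw [memLp_two_iff_integrable_sq]
  · exact (integrable_prod_mul_prod hu a a).congr (Filter.Eventually.of_forall fun z => (sq _).symm)
  · exact Finset.aestronglyMeasurable_fun_prod _ fun j _ =>
      (hu (a j)).1.comp_quasiMeasurePreserving (Measure.quasiMeasurePreserving_eval _ j)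

theorem integral_prod_mul_prod [DecidableEq κ]
    (ho : ∀ k l, ∫ x, u k x * u l x = if k = l then 1 else 0) (a b : ι → κ) :
    ∫ z : ι → E3, (∏ j, u (a j) (z j)) * ∏ j, u (b j) (z j)
      = ∏ j, if a j = b j then 1 else 0 := by
  simp only [← Finset.prod_mul_distrib]
  rw [integral_fintype_prod_volume_eq_prod (f := fun j x => u (a j) x * u (b j) x)]
  simp only [ho]

end OrthonormalProducts

/-! ### Determinants with one distinguished particle. -/

section SlotDet

variable {N : ℕ}

/-- The Slater determinant of `u` with the orbitals of particle `i` replaced by those of `w`. -/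
def slotDet (u w : Fin N → E3 → ℝ) (i : Fin N) (X : Conf N) : ℝ :=
  (Real.sqrt (Nat.factorial N))⁻¹ * ∑ σ : Equiv.Perm (Fin N),
    (Equiv.Perm.sign σ : ℝ) * (w (σ i) (X i) * ∏ j : {j // j ≠ i}, u (σ j) (X j))

/-- Leibniz expansion with the factor of particle i singled out, so that differentiating in x_i acts
on one orbital per term. -/
theorem slaterDet_eq_slotDet (u : Fin N → E3 → ℝ) (i : Fin N) (X : Conf N) :
    slaterDet (fun k x => (u k x : ℂ)) X = (slotDet u u i X : ℂ) := by
  unfold slaterDet slotDet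
  rw [Matrix.det_apply]
  push_cast
  refine congrArg _ (Finset.sum_congr rfl fun σ _ => ?_)
  rw [Units.smul_def, zsmul_eq_mul,
    Fintype.prod_eq_mul_prod_subtype_ne (fun j => Matrix.of (fun i j => (u i (X j) : ℂ)) (σ j) j) i]
  simp

/-- A permutation is determined by its values off one point. This removes the cross terms when the
other N - 1 particles are integrated out. -/
theorem prod_ite_perm_eq (i : Fin N) (σ τ : Equiv.Perm (Fin N)) :
    (∏ j : {j // j ≠ i}, if σ j = τ j then (1 : ℝ) else 0) = if σ = τ then 1 else 0 := by
  split_ifs with h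
  · simp [h]
  · by_contra h0
    refine h (Equiv.ext fun k => ?_)
    have h1 : ∀ j, j ≠ i → σ j = τ j := fun j hj => by
      by_contra hc
      exact h0 (Finset.prod_eq_zero (Finset.mem_univ (⟨j, hj⟩ : {j // j ≠ i})) (by simp [hc]))
    by_cases hk : k = i
    · subst hk
      obtain ⟨m, hm⟩ := τ.surjective (σ k)
      by_cases hmk : m = k
      · rw [← hm, hmk]
      · exact absurd (σ.injective ((h1 m hmk).trans hm)) hmk
    · exact h1 k hk

theorem sum_perm_apply (f : Fin N → ℝ) :
    (∑ i : Fin N, ∑ σ : Equiv.Perm (Fin N), f (σ i)) = Nat.factorial N * ∑ k, f k := by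
  rw [Finset.sum_comm]
  simp [Equiv.sum_comp, Fintype.card_perm]

variable {u : Fin N → E3 → ℝ}

/-- Orthonormality of u leaves only the diagonal σ = τ. Nothing is asked of w, so the formula yields
the density (w = u) and the kinetic energy (w = ∂u). -/
theorem integral_slotDet_sq (hu : ∀ k, MemLp (u k) 2 volume)
    (ho : ∀ k l, ∫ x, u k x * u l x = if k = l then 1 else 0) (w : Fin N → E3 → ℝ) (i : Fin N)
    (x : E3) : ∫ z, slotDet u w i (insertAt i x z) ^ 2
      = (Nat.factorial N : ℝ)⁻¹ * ∑ σ : Equiv.Perm (Fin N), w (σ i) x ^ 2 := by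
  have e : ∀ z, slotDet u w i (insertAt i x z) ^ 2 = (Nat.factorial N : ℝ)⁻¹ *
      ∑ σ : Equiv.Perm (Fin N), ∑ τ : Equiv.Perm (Fin N),
        ((Equiv.Perm.sign σ : ℝ) * w (σ i) x * ((Equiv.Perm.sign τ : ℝ) * w (τ i) x)) *
          ((∏ j : {j // j ≠ i}, u (σ j) (z j)) * ∏ j : {j // j ≠ i}, u (τ j) (z j)) := fun z => by
    simp only [slotDet, insertAt_self, insertAt_coe]
    rw [mul_pow, inv_pow, Real.sq_sqrt (Nat.cast_nonneg _), sq (∑ σ, _), Finset.sum_mul_sum]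
    refine congrArg _ (Finset.sum_congr rfl fun σ _ => Finset.sum_congr rfl fun τ _ => ?_)
    ring
  have hi := fun σ τ : Equiv.Perm (Fin N) => integrable_prod_mul_prod hu
    (fun j : {j // j ≠ i} => σ j) (fun j => τ j)
  simp only [e]
  rw [integral_const_mul, integral_finsetSum _ fun σ _ => integrable_finsetSum _ fun τ _ =>
    (hi σ τ).const_mul _]
  refine congrArg _ (Finset.sum_congr rfl fun σ _ => ?_)
  rw [integral_finsetSum _ fun τ _ => (hi σ τ).const_mul _]
  simp only [integral_const_mul]
  have ho' := fun τ : Equiv.Perm (Fin N) => (integral_prod_mul_prod ho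
    (fun j : {j // j ≠ i} => σ j) (fun j => τ j)).trans (prod_ite_perm_eq i σ τ)
  simp only [ho', mul_ite, mul_one, mul_zero, Finset.sum_ite_eq, Finset.mem_univ, if_true]
  rcases Int.units_eq_one_or (Equiv.Perm.sign σ) with h | h <;> simp [h, sq]

theorem memLp_slotDet (hu : ∀ k, MemLp (u k) 2 volume) {w : Fin N → E3 → ℝ}
    (hw : ∀ k, MemLp (w k) 2 volume) (i : Fin N) :
    MemLp (fun X => (slotDet u w i X : ℂ)) 2 volume := by
  have h := (memLp_finsetSum (μ := volume) Finset.univ fun (σ : Equiv.Perm (Fin N)) _ =>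
    (memLp_mul_restrict i (hw (σ i)).ofReal (memLp_fintype_prod hu
      fun j : {j // j ≠ i} => σ j)).const_mul ((Equiv.Perm.sign σ : ℤ) : ℂ)).const_mul
        ((Real.sqrt (Nat.factorial N))⁻¹ : ℂ)
  refine h.ae_eq (Filter.Eventually.of_forall fun X => ?_)
  simp [slotDet]

theorem hasWeakDeriv_slotDet (hu : ∀ k, MemLp (u k) 2 volume) {w d : Fin N → E3 → ℝ}
    (hw : ∀ k, MemLp (w k) 2 volume) (hd : ∀ k, MemLp (d k) 2 volume) {a : Fin 3}
    (h : ∀ k, HasWeakDeriv (w k) (d k) (dir a)) (i : Fin N) :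
    HasWeakDeriv (fun X => (slotDet u w i X : ℂ)) (fun X => (slotDet u d i X : ℂ))
      (confDir i a) := by
  have hc := fun σ : Equiv.Perm (Fin N) => memLp_fintype_prod hu fun j : {j // j ≠ i} => σ j
  have hl : ∀ {v : Fin N → E3 → ℝ}, (∀ k, MemLp (v k) 2 volume) → ∀ σ : Equiv.Perm (Fin N),
      LocallyIntegrable (fun X : Conf N => ((Equiv.Perm.sign σ : ℤ) : ℂ) •
        ((v (σ i) (X i) : ℂ) * ((∏ j : {j // j ≠ i}, u (σ j) (X j) : ℝ) : ℂ))) := fun hv σ =>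
    ((memLp_mul_restrict i (hv (σ i)).ofReal (hc σ)).const_smul
      ((Equiv.Perm.sign σ : ℤ) : ℂ)).locallyIntegrable (by norm_num)
  have := (HasWeakDeriv.sum Finset.univ (fun σ _ => hl hw σ) (fun σ _ => hl hd σ) fun σ _ =>
    ((h (σ i)).ofReal.mul_restrict (hw (σ i)).ofReal (hd (σ i)).ofReal i (hc σ)).const_smul
      ((Equiv.Perm.sign σ : ℤ) : ℂ)).const_smul ((Real.sqrt (Nat.factorial N))⁻¹ : ℂ)
  refine this.congr (Filter.Eventually.of_forall fun X => ?_)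
    (Filter.Eventually.of_forall fun X => ?_) <;> simp [slotDet]

end SlotDet

/-! ### The energy of a Slater determinant -/

section SlaterEnergy

variable {N : ℕ} {u : Fin N → E3 → ℝ}

theorem IsOrthonormalTuple.memLp (hu : IsOrthonormalTuple u) (k : Fin N) :
    MemLp (u k) 2 volume := (hu.memH1 k).1

theorem IsOrthonormalTuple.density_slaterDet (hu : IsOrthonormalTuple u) (x : E3) :
    density (slaterDet fun k x => (u k x : ℂ)) x = ∑ k, u k x ^ 2 := by
  have h : ∀ i, ∫ z, ‖slaterDet (fun k x => (u k x : ℂ)) (insertAt i x z)‖ ^ 2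
      = (Nat.factorial N : ℝ)⁻¹ * ∑ σ : Equiv.Perm (Fin N), u (σ i) x ^ 2 := fun i => by
    simp only [slaterDet_eq_slotDet u i, Complex.norm_real, Real.norm_eq_abs, sq_abs]
    exact integral_slotDet_sq hu.memLp hu.orthonormal u i x
  simp only [density, h]
  rw [← Finset.mul_sum, sum_perm_apply (fun k => u k x ^ 2),
    inv_mul_cancel_left₀ (by exact_mod_cast Nat.factorial_ne_zero N)]

theorem IsOrthonormalTuple.memLp_slaterDet (hu : IsOrthonormalTuple u) (i : Fin N) :
    MemLp (slaterDet fun k x => (u k x : ℂ)) 2 volume := by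
  have := memLp_slotDet hu.memLp hu.memLp i
  simpa only [← slaterDet_eq_slotDet u i] using this

theorem IsOrthonormalTuple.hasWeakDeriv_slaterDet (hu : IsOrthonormalTuple u) (i : Fin N)
    (a : Fin 3) : HasWeakDeriv (slaterDet fun k x => (u k x : ℂ))
      (fun X => (slotDet u (fun k => weakDeriv (u k) (dir a)) i X : ℂ)) (confDir i a) := by
  have := hasWeakDeriv_slotDet hu.memLp hu.memLp
    (fun k => ((hu.memH1 k).weakDeriv_spec (dir a)).1)
    (fun k => ((hu.memH1 k).weakDeriv_spec (dir a)).2) i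
  simpa only [← slaterDet_eq_slotDet u i] using this

theorem IsOrthonormalTuple.memLp_slotDet_weakDeriv (hu : IsOrthonormalTuple u) (i : Fin N)
    (a : Fin 3) :
    MemLp (fun X => (slotDet u (fun k => weakDeriv (u k) (dir a)) i X : ℂ)) 2 volume :=
  memLp_slotDet hu.memLp (fun k => ((hu.memH1 k).weakDeriv_spec (dir a)).1) i

theorem IsOrthonormalTuple.memH1_slaterDet (hu : IsOrthonormalTuple u) (i : Fin N) :
    MemH1 (slaterDet fun k x => (u k x : ℂ)) :=
  memH1_of_confDir (hu.memLp_slaterDet i) fun i a =>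
    ⟨_, hu.memLp_slotDet_weakDeriv i a, hu.hasWeakDeriv_slaterDet i a⟩

/-- The norm is read off from the density: N‖Ψ‖² = ∫ρ = Σ‖u_k‖² = N, and i witnesses N ≠ 0. -/
theorem IsOrthonormalTuple.integral_norm_sq_slaterDet (hu : IsOrthonormalTuple u) (i : Fin N) :
    ∫ X, ‖slaterDet (fun k x => (u k x : ℂ)) X‖ ^ 2 = 1 := by
  have hN : (N : ℝ) ≠ 0 := by exact_mod_cast (Fin.pos i).ne'
  have h1 := integral_density (hu.memLp_slaterDet i)
  simp only [hu.density_slaterDet] at h1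
  rw [integral_finsetSum _ fun k _ => (hu.memLp k).integrable_sq] at h1
  simp only [sq (u _ _), hu.orthonormal] at h1
  simpa [hN] using h1

theorem IsOrthonormalTuple.kinetic_slaterDet (hu : IsOrthonormalTuple u) (a : Fin 3) :
    ∑ i, ∫ X, ‖weakDeriv (slaterDet fun k x => (u k x : ℂ)) (confDir i a) X‖ ^ 2
      = ∑ k, ∫ x, weakDeriv (u k) (dir a) x ^ 2 := by
  have hd := fun k => ((hu.memH1 k).weakDeriv_spec (dir a)).1
  have h : ∀ i, ∫ X, ‖weakDeriv (slaterDet fun k x => (u k x : ℂ)) (confDir i a) X‖ ^ 2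
      = (Nat.factorial N : ℝ)⁻¹ * ∑ σ : Equiv.Perm (Fin N),
          ∫ x, weakDeriv (u (σ i)) (dir a) x ^ 2 := fun i => by
    have hm := hu.memLp_slotDet_weakDeriv i a
    have e : ∫ X, ‖weakDeriv (slaterDet fun k x => (u k x : ℂ)) (confDir i a) X‖ ^ 2
        = ∫ X, ‖(slotDet u (fun k => weakDeriv (u k) (dir a)) i X : ℂ)‖ ^ 2 := by
      refine integral_congr_ae ?_
      filter_upwards [HasWeakDeriv.ae_eq_weakDeriv hm (hu.hasWeakDeriv_slaterDet i a)] with X hX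
      rw [hX]
    rw [e, integral_conf_iterated i ((memLp_two_iff_integrable_sq_norm hm.1).1 hm)]
    simp only [Complex.norm_real, Real.norm_eq_abs, sq_abs,
      integral_slotDet_sq hu.memLp hu.orthonormal]
    rw [integral_const_mul, integral_finsetSum _ fun σ _ => (hd (σ i)).integrable_sq]
  simp only [h]
  rw [← Finset.mul_sum, sum_perm_apply (fun k => ∫ x, weakDeriv (u k) (dir a) x ^ 2),
    inv_mul_cancel_left₀ (by exact_mod_cast Nat.factorial_ne_zero N)]

theorem IsOrthonormalTuple.manyBodyEnergy_slaterDet {K : ℕ} (hu : IsOrthonormalTuple u)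
    (i : Fin N) (p α : ℝ) (y : Fin K → E3) :
    manyBodyEnergy p α y (slaterDet fun k x => (u k x : ℂ)) = orbitalEnergy p α y u := by
  have hV : ∀ k, Integrable fun x => coulomb y x * u k x ^ 2 := fun k =>
    integrable_coulomb_mul y (fun x => sq_nonneg _) (hu.memLp k).integrable_sq
      (integrable_pow_six_of_memLp (hu.memH1 k).memLp_six)
  have h3 : Integrable fun x => density (slaterDet fun k x => (u k x : ℂ)) x ^ 3 := by
    simpa only [hu.density_slaterDet] using integrable_sum_sq_cube hu.memH1
  -- Scaling by 1 serves to split each one-body integral into kinetic and potential parts.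
  have h1 := fun k => integral_oneBody_smul y (fun a => ((hu.memH1 k).weakDeriv_spec (dir a)).1)
    (fun a => ((hu.memH1 k).weakDeriv_spec (dir a)).2) (hV k) 1
  simp only [one_mul, one_pow, sq_abs] at h1
  rw [manyBodyEnergy_eq p α y (hu.memH1_slaterDet i) h3]
  simp only [hu.kinetic_slaterDet, hu.density_slaterDet, orbitalEnergy, sq_abs, h1,
    Finset.mul_sum]
  rw [integral_finsetSum _ fun k _ => hV k, Finset.sum_add_distrib, Finset.sum_comm]

theorem IsOrthonormalTuple.isSlater_slaterDet (hu : IsOrthonormalTuple u) :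
    IsSlater (slaterDet fun k x => (u k x : ℂ)) := by
  refine ⟨_, fun k => (hu.memLp k).ofReal, fun k l => ?_, .refl _ _⟩
  have h : ∀ x, (u k x : ℂ) * (starRingEnd ℂ) (u l x : ℂ) = ((u k x * u l x : ℝ) : ℂ) :=
    fun x => by rw [Complex.conj_ofReal, Complex.ofReal_mul]
  refine (integral_congr_ae (Filter.Eventually.of_forall h)).trans ?_
  rw [integral_complex_ofReal, hu.orthonormal]
  split_ifs <;> simp

end SlaterEnergy

theorem slaterInf_le_orbitalInf {N : ℕ} (hN : 0 < N) {K : ℕ} (p α : ℝ) (y : Fin K → E3) :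
    slaterInf N p α y ≤ orbitalInf N p α y := by
  refine le_iInf₂ fun u hu => ?_
  have hu : IsOrthonormalTuple u := hu
  let i : Fin N := ⟨0, hN⟩
  rw [← hu.manyBodyEnergy_slaterDet i]
  refine iInf₂_le _ ⟨hu.isSlater_slaterDet, hu.memH1_slaterDet i,
    Filter.Eventually.of_forall fun X => ?_, hu.integral_norm_sq_slaterDet i⟩
  rw [slaterDet_eq_slotDet u i, Complex.ofReal_im]

end FermionicNLS

end

theorem mainTheorem3 (N K : ℕ) (hN : 1 ≤ N) (hK : 1 ≤ K)
    (p α : ℝ) (hp : 1 < p) (hp' : p < 5 / 3) (hα : 0 < α)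
    (y : Fin K → FermionicNLS.E3) (hy : Function.Injective y) :
    FermionicNLS.fermionicEnergy N p α y = FermionicNLS.orbitalInf N p α y ∧
      FermionicNLS.orbitalInf N p α y = FermionicNLS.slaterInf N p α y := by
  have hN0 : 0 < N := hN
  have h1 := FermionicNLS.fermionicEnergy_le_slaterInf N p α y
  have h2 := FermionicNLS.slaterInf_le_orbitalInf hN0 p α y
  -- Here p < 5/3 enters as p ≤ 3, the range where ρ^p is dominated by ρ + ρ³.
  have h3 := FermionicNLS.orbitalInf_le_fermionicEnergy hN0 hp (by linarith) hα y
  exact ⟨le_antisymm (h1.trans h2) h3, le_antisymm (h3.trans h1) h2⟩
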